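/- For a measurable real-valued function $f$ on a measurable set $\Omega\subset\mathbb R^n$ and $1\le p<\infty$, let $$\|f\|_{L^{p,\infty}(\Omega)}=\inf\bigl\{C>0:\ |\{x\in\Omega:|f(x)|>\alpha\}|\le C^p/\alpha^p\ \text{ for all }\alpha>0\bigr\},$$ and let $L^{p,\infty}(\Omega)$ be the set of those $f$ for which this is finite. Let $\mathrm{BMO}(\mathbb R^n)$ be the set of $f\in L^1_{\mathrm{loc}}(\mathbb R^n)$ with $$\|f\|_{\mathrm{BMO}}=\sup_Q \frac1{|Q|}\int_Q|f-f_Q|\,dx<\infty,\qquad f_Q=\frac1{|Q|}\int_Q f\,dx,$$ where the supremum is over all cubes $Q$ with sides parallel to the axes. Gradients are weak gradients, and $\dot H^1(\mathbb R^2)$ denotes the set of $f\in L^1_{\mathrm{loc}}(\mathbb R^2)$ with $\nabla f\in L^2(\mathbb R^2)$. (i) Let $n\ge1$ and $1\le q<p<\infty$. There is a constant $c=c(n,p,q)$ such that every $f\in L^{q,\infty}(\mathbb R^n)\cap\mathrm{BMO}(\mathbb R^n)$ lies in $L^p(\mathbb R^n)$ and $$\|f\|_{L^p}\le c\,\|f\|_{L^{q,\infty}}^{q/p}\,\|f\|_{\mathrm{BMO}}^{1-q/p}.$$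 (ii) $\dot H^1(\mathbb R^2)\subset\mathrm{BMO}(\mathbb R^2)$, with $\|f\|_{\mathrm{BMO}}\le c\,\|\nabla f\|_{L^2}$ for an absolute constant $c$. (iii) (Weak Ladyzhenskaya inequality.) There is an absolute constant $c$ such that the estimate $$\|f\|_{L^4(\Omega)}\le c\,\|f\|_{L^{2,\infty}(\Omega)}^{1/2}\,\|\nabla f\|_{L^2(\Omega)}^{1/2}$$ (in particular $f\in L^4(\Omega)$) holds in each of the following cases: - $\Omega=\mathbb R^2$ and $f\in L^{2,\infty}(\mathbb R^2)\cap\dot H^1(\mathbb R^2)$; - $\Omega\subset\mathbb R^2$ is a bounded open set (for instance a bounded Lipschitz domain) and $f\in H^1_0(\Omega)$, the closure of $C_c^\infty(\Omega)$ in $H^1(\Omega)$; - $\Omega=[0,1]^2$ with periodic boundary conditions, and $f\in H^1$ is periodic with zero mean, $\int_{[0,1]^2}f\,dx=0$. -/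

import Mathlib

open MeasureTheory Filter Topology
open scoped ENNReal NNReal ContDiff

/-- The distribution function `d_f(α) = μ {x : |f x| > α}`. For functions on a measurable set `Ω`,
take `μ` to be Lebesgue measure restricted to `Ω`. -/
noncomputable def distribFun {X : Type*} [MeasurableSpace X] (f : X → ℝ) (μ : Measure X)
    (α : ℝ) : ℝ≥0∞ :=
  μ {x | α < |f x|}

/-- The weak `L^p` quasi-norm, the infimum of all `C > 0` such that `d_f(α) ≤ C^p / α^p` for all
`α > 0`; it is `∞` when there is no such `C`. -/
noncomputable def weakLpNorm {X : Type*} [MeasurableSpace X] (f : X → ℝ) (p : ℝ)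
    (μ : Measure X) : ℝ≥0∞ :=
  ⨅ (C : ℝ) (_ : 0 < C ∧ ∀ α : ℝ, 0 < α → distribFun f μ α ≤ ENNReal.ofReal (C ^ p / α ^ p)),
    ENNReal.ofReal C

/-- Membership in the weak Lebesgue space `L^{p,∞}(μ)`. -/
def MemWeakLp {X : Type*} [MeasurableSpace X] (f : X → ℝ) (p : ℝ) (μ : Measure X) : Prop :=
  AEStronglyMeasurable f μ ∧ weakLpNorm f p μ < ⊤

/-- The closed cube with lowest corner `a` and side length `s`, with sides parallel to the axes. -/
def axisCube {n : ℕ} (a : EuclideanSpace ℝ (Fin n)) (s : ℝ) : Set (EuclideanSpace ℝ (Fin n)) :=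
  {x | ∀ i, x i ∈ Set.Icc (a i) (a i + s)}

/-- The `BMO` seminorm, the supremum over all cubes `Q` of the mean oscillation
`⨍_Q |f - f_Q|`, where `f_Q = ⨍_Q f`. -/
noncomputable def bmoSeminorm {n : ℕ} (f : EuclideanSpace ℝ (Fin n) → ℝ) : ℝ≥0∞ :=
  ⨆ (a : EuclideanSpace ℝ (Fin n)) (s : ℝ) (_ : 0 < s),
    ⨍⁻ x in axisCube a s, ‖f x - ⨍ y in axisCube a s, f y‖ₑ ∂volume

/-- Membership in `BMO(ℝⁿ)`. -/
def MemBMO {n : ℕ} (f : EuclideanSpace ℝ (Fin n) → ℝ) : Prop :=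
  LocallyIntegrable f volume ∧ bmoSeminorm f < ⊤

/-- Test functions, the elements of `C_c^∞(Ω)`. -/
def IsTestFunction {n : ℕ} (Ω : Set (EuclideanSpace ℝ (Fin n)))
    (φ : EuclideanSpace ℝ (Fin n) → ℝ) : Prop :=
  ContDiff ℝ ∞ φ ∧ HasCompactSupport φ ∧ tsupport φ ⊆ Ω

/-- `g` is the weak gradient of `f` in the open set `Ω`. -/
def IsWeakGradient {n : ℕ} (Ω : Set (EuclideanSpace ℝ (Fin n)))
    (f : EuclideanSpace ℝ (Fin n) → ℝ)
    (g : EuclideanSpace ℝ (Fin n) → EuclideanSpace ℝ (Fin n)) : Prop :=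
  LocallyIntegrableOn f Ω volume ∧ LocallyIntegrableOn g Ω volume ∧
    ∀ φ : EuclideanSpace ℝ (Fin n) → ℝ, IsTestFunction Ω φ → ∀ i : Fin n,
      ∫ x in Ω, f x * (gradient φ x) i = -∫ x in Ω, (g x) i * φ x

/-- `f` belongs to the homogeneous space `Ḣ¹(ℝⁿ)` and `∇f = g`. -/
def MemHomH1 {n : ℕ} (f : EuclideanSpace ℝ (Fin n) → ℝ)
    (g : EuclideanSpace ℝ (Fin n) → EuclideanSpace ℝ (Fin n)) : Prop :=
  IsWeakGradient Set.univ f g ∧ MemLp g 2 volume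

/-- `f` belongs to `H¹(Ω)` and `∇f = g`. -/
def MemH1 {n : ℕ} (Ω : Set (EuclideanSpace ℝ (Fin n))) (f : EuclideanSpace ℝ (Fin n) → ℝ)
    (g : EuclideanSpace ℝ (Fin n) → EuclideanSpace ℝ (Fin n)) : Prop :=
  IsWeakGradient Ω f g ∧ MemLp f 2 (volume.restrict Ω) ∧ MemLp g 2 (volume.restrict Ω)

/-- `f` belongs to `H¹₀(Ω)`, the closure of `C_c^∞(Ω)` in `H¹(Ω)`, and `∇f = g`. -/
def MemH10 {n : ℕ} (Ω : Set (EuclideanSpace ℝ (Fin n))) (f : EuclideanSpace ℝ (Fin n) → ℝ)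
    (g : EuclideanSpace ℝ (Fin n) → EuclideanSpace ℝ (Fin n)) : Prop :=
  MemH1 Ω f g ∧ ∃ φ : ℕ → EuclideanSpace ℝ (Fin n) → ℝ, (∀ k, IsTestFunction Ω (φ k)) ∧
    Tendsto (fun k => eLpNorm (fun x => φ k x - f x) 2 (volume.restrict Ω)) atTop (𝓝 0) ∧
    Tendsto (fun k => eLpNorm (fun x => gradient (φ k) x - g x) 2 (volume.restrict Ω))
      atTop (𝓝 0)

/-- `f` belongs to `H¹` of the unit cube `[0,1]ⁿ` with periodic boundary conditions and `∇f = g`: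
`f` is a `ℤⁿ`-periodic function on `ℝⁿ` with weak gradient `g` on `ℝⁿ`, and `f` and `g` are square
integrable on the unit cube. -/
def MemH1Per {n : ℕ} (f : EuclideanSpace ℝ (Fin n) → ℝ)
    (g : EuclideanSpace ℝ (Fin n) → EuclideanSpace ℝ (Fin n)) : Prop :=
  (∀ i : Fin n, (fun x => f (x + EuclideanSpace.single i 1)) =ᵐ[volume] f) ∧
    IsWeakGradient Set.univ f g ∧
    MemLp f 2 (volume.restrict (axisCube 0 1)) ∧ MemLp g 2 (volume.restrict (axisCube 0 1))

/-!
Bounded mean oscillation makes the distribution function decay exponentially (John–Nirenberg): above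
a fixed multiple of the oscillation, raising the threshold by another multiple of it halves the
superlevel set of the dyadic maximal function, as the stopping cells at the lower threshold show. If
the bound is by the distribution function at a lower level instead of the measure of the whole cube,
it survives the exhaustion of `ℝⁿ` by cubes, and the layer cake formula, with the weak bound at low
levels and the exponential one at high levels, gives the interpolation inequality.

A weakly differentiable function satisfies the Poincaré inequality on cubes because the differences
`f (x + v) - f x` are integrals of the gradient along segments. By Hölder's inequality its mean
oscillation is bounded by the `Lⁿ` norm of the gradient, which is the `L²` norm in the plane.
Inserted into the interpolation inequality, this bound gives the weak Ladyzhenskaya inequality.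
Functions in `H¹₀(Ω)` are extended by zero; on a single cube only the oscillation over its subcubes
is needed.
-/

/-! ### Nested partitions -/

/-- A sequence of measurable partitions of `X`, each of them refining the previous one. The `k`-th
partition is encoded by the map `c k` which sends a point to the index of its cell. -/
structure IsNestedPartition {X ι : Type*} [MeasurableSpace X] (c : ℕ → X → ι) : Prop where
  measurableSet_preimage : ∀ k j, MeasurableSet (c k ⁻¹' {j})
  refines : ∀ {k x y}, c (k + 1) x = c (k + 1) y → c k x = c k y

/-- The cell of the `k`-th partition which contains `x`. -/
def cell {X ι : Type*} (c : ℕ → X → ι) (k : ℕ) (x : X) : Set X :=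
  {y | c k y = c k x}

/-- The superlevel set at height `l` of the maximal function of `f` over the cells contained
in `P`. -/
def maximalSet {X ι : Type*} [MeasurableSpace X] (c : ℕ → X → ι) (μ : Measure X) (f : X → ℝ)
    (P : Set X) (l : ℝ) : Set X :=
  {x | ∃ k, cell c k x ⊆ P ∧ l < |⨍ z in cell c k x, f z ∂μ|}

/-- The mean oscillation of `f` over every cell contained in `P` is at most `B`. -/
def MeanOscillationLE {X ι : Type*} [MeasurableSpace X] (c : ℕ → X → ι) (μ : Measure X) (f : X → ℝ)
    (P : Set X) (B : ℝ) : Prop :=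
  ∀ k x, cell c k x ⊆ P → ∫⁻ y in cell c k x, ‖f y - ⨍ z in cell c k x, f z ∂μ‖ₑ ∂μ ≤
    ENNReal.ofReal B * μ (cell c k x)

section Cells

variable {X ι : Type*} {c : ℕ → X → ι} {i k : ℕ} {x y : X}

theorem mem_cell_self : x ∈ cell c k x := rfl

theorem cell_eq_of_mem (h : y ∈ cell c k x) : cell c k y = cell c k x := by
  ext z
  exact Eq.congr_right h

theorem countable_setOf_cell [Countable ι] (c : ℕ → X → ι) :
    {R | ∃ k x, R = cell c k x}.Countable := by
  refine (Set.countable_range fun s : ℕ × ι => c s.1 ⁻¹' {s.2}).mono ?_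
  rintro _ ⟨k, x, rfl⟩
  exact ⟨(k, c k x), rfl⟩

variable [MeasurableSpace X]

theorem IsNestedPartition.cell_subset_cell (hc : IsNestedPartition c) (hik : i ≤ k) :
    cell c k x ⊆ cell c i x := by
  induction hik with
  | refl => exact subset_rfl
  | step _ ih => exact fun y hy => ih (hc.refines hy)

theorem IsNestedPartition.measurableSet_cell (hc : IsNestedPartition c) :
    MeasurableSet (cell c k x) :=
  hc.measurableSet_preimage k (c k x)

variable [Countable ι]

theorem IsNestedPartition.measurableSet_exists_cell (hc : IsNestedPartition c)
    (p : Set X → Prop) : MeasurableSet {x | ∃ k, p (cell c k x)} := by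
  have hunion : {x | ∃ k, p (cell c k x)} = ⋃₀ {R | (∃ k x, R = cell c k x) ∧ p R} := by
    ext x
    constructor
    · rintro ⟨k, hk⟩
      exact ⟨_, ⟨⟨k, x, rfl⟩, hk⟩, mem_cell_self⟩
    · rintro ⟨_, ⟨⟨k, y, rfl⟩, hp⟩, hx⟩
      exact ⟨k, cell_eq_of_mem hx ▸ hp⟩
  rw [hunion]
  refine .sUnion ((countable_setOf_cell c).mono fun R hR => hR.1) ?_
  rintro _ ⟨⟨k, y, rfl⟩, -⟩
  exact hc.measurableSet_cell

/-- The maximal cells with the property `p` partition the union of all cells with that property. -/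
theorem IsNestedPartition.measure_exists_cell_le (hc : IsNestedPartition c) {ν₁ ν₂ : Measure X}
    (p : Set X → Prop)
    (h : ∀ k x, p (cell c k x) → (∀ i < k, ¬ p (cell c i x)) →
      ν₁ (cell c k x) ≤ ν₂ (cell c k x)) :
    ν₁ {x | ∃ k, p (cell c k x)} ≤ ν₂ {x | ∃ k, p (cell c k x)} := by
  classical
  set S : Set (Set X) := {R | ∃ k x, R = cell c k x ∧ p R ∧ ∀ i < k, ¬ p (cell c i x)}
  have hunion : {x | ∃ k, p (cell c k x)} = ⋃₀ S := by
    ext x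
    constructor
    · intro hx
      exact ⟨_, ⟨Nat.find hx, x, rfl, Nat.find_spec hx, fun i => Nat.find_min hx⟩, mem_cell_self⟩
    · rintro ⟨_, ⟨k, y, rfl, hp, -⟩, hx⟩
      exact ⟨k, cell_eq_of_mem hx ▸ hp⟩
  have not_lt_of_mem {k k' : ℕ} {x x' y : X} (hy : y ∈ cell c k x) (hy' : y ∈ cell c k' x')
      (hp : p (cell c k x)) (hmin : ∀ i < k', ¬ p (cell c i x')) : ¬ k < k' := fun hlt => by
    refine hmin k hlt ?_
    rwa [← cell_eq_of_mem (hc.cell_subset_cell hlt.le hy'), cell_eq_of_mem hy]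
  have hdisj : S.PairwiseDisjoint id := by
    rintro _ ⟨k, x, rfl, hp, hmin⟩ _ ⟨k', x', rfl, hp', hmin'⟩ hne
    refine Set.disjoint_left.2 fun y hy hy' => hne ?_
    obtain rfl : k = k' := le_antisymm (not_lt.1 (not_lt_of_mem hy' hy hp' hmin))
      (not_lt.1 (not_lt_of_mem hy hy' hp hmin'))
    exact (cell_eq_of_mem hy).symm.trans (cell_eq_of_mem hy')
  have hcount : S.Countable := (countable_setOf_cell c).mono
    fun _ ⟨k, x, hR, _⟩ => (⟨k, x, hR⟩ : ∃ k x, _ = cell c k x)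
  have hmeas : ∀ R ∈ S, MeasurableSet R := by
    rintro _ ⟨k, x, rfl, -⟩
    exact hc.measurableSet_cell
  rw [hunion, measure_sUnion hcount hdisj hmeas, measure_sUnion hcount hdisj hmeas]
  refine ENNReal.tsum_le_tsum ?_
  rintro ⟨_, k, x, rfl, hp, hmin⟩
  exact h k x hp hmin

end Cells

/-! ### Averages and oscillation -/

section Oscillation

variable {X : Type*} [MeasurableSpace X] {μ : Measure X} [IsFiniteMeasure μ]

theorem enorm_average_sub_mul_measure_univ_le {E : Type*} [NormedAddCommGroup E] [NormedSpace ℝ E]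
    [CompleteSpace E] {f : X → E} (hf : Integrable f μ) (a : E) :
    ‖(⨍ x, f x ∂μ) - a‖ₑ * μ Set.univ ≤ ∫⁻ x, ‖f x - a‖ₑ ∂μ := by
  have hint : ∫ x, (f x - a) ∂μ = μ.real Set.univ • ((⨍ x, f x ∂μ) - a) := by
    rw [integral_sub hf (integrable_const a), smul_sub, measure_smul_average, integral_const]
  calc ‖(⨍ x, f x ∂μ) - a‖ₑ * μ Set.univ = ‖∫ x, (f x - a) ∂μ‖ₑ := by
        rw [hint, enorm_smul, mul_comm, Real.enorm_eq_ofReal measureReal_nonneg,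
          ofReal_measureReal]
    _ ≤ ∫⁻ x, ‖f x - a‖ₑ ∂μ := enorm_integral_le_lintegral_enorm _

variable {f : X → ℝ} {b l : ℝ}

theorem measure_univ_le_two_mul_distribFun (hf : AEStronglyMeasurable f μ) (hb : 0 < b)
    (hl : 4 * b ≤ l) (havg : l < |⨍ x, f x ∂μ|)
    (hosc : ∫⁻ x, ‖f x - ⨍ y, f y ∂μ‖ₑ ∂μ ≤ ENNReal.ofReal b * μ Set.univ) :
    μ Set.univ ≤ 2 * distribFun f μ (l / 2) := by
  set a := ⨍ x, f x ∂μ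
  set far := {x | ENNReal.ofReal (2 * b) ≤ ‖f x - a‖ₑ}
  have hcover : Set.univ ⊆ {x | l / 2 < |f x|} ∪ far := fun x _ => by
    refine or_iff_not_imp_left.2 fun hx => ?_
    rw [Set.mem_ofPred_eq, Real.enorm_eq_ofReal_abs]
    refine ENNReal.ofReal_le_ofReal ?_
    have htri := abs_sub_abs_le_abs_sub a (f x)
    rw [abs_sub_comm] at htri
    have hle : |f x| ≤ l / 2 := not_lt.1 hx
    linarith
  have hfar : 2 * μ far ≤ μ Set.univ := by
    have hcheb : ENNReal.ofReal (2 * b) * μ far ≤ ENNReal.ofReal b * μ Set.univ :=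
      (mul_meas_ge_le_lintegral₀ (hf.sub aestronglyMeasurable_const).enorm _).trans hosc
    rw [mul_comm 2 b, ENNReal.ofReal_mul hb.le, ENNReal.ofReal_ofNat, mul_assoc] at hcheb
    exact (ENNReal.mul_le_mul_iff_right (by simpa using hb) ENNReal.ofReal_ne_top).1 hcheb
  refine (ENNReal.add_le_add_iff_right (measure_ne_top μ Set.univ)).1 ?_
  calc μ Set.univ + μ Set.univ = 2 * μ Set.univ := (two_mul _).symm
    _ ≤ 2 * (distribFun f μ (l / 2) + μ far) := by
      gcongr
      exact (measure_mono hcover).trans (measure_union_le _ _)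
    _ ≤ 2 * distribFun f μ (l / 2) + μ Set.univ := by rw [mul_add]; gcongr

theorem abs_average_le_of_two_mul_distribFun_lt (hf : AEStronglyMeasurable f μ) (hb : 0 < b)
    (hosc : ∫⁻ x, ‖f x - ⨍ y, f y ∂μ‖ₑ ∂μ ≤ ENNReal.ofReal b * μ Set.univ)
    (hlt : 2 * distribFun f μ (2 * b) < μ Set.univ) :
    |⨍ x, f x ∂μ| ≤ 4 * b := by
  by_contra! havg
  refine hlt.not_ge ?_
  simpa only [show 4 * b / 2 = 2 * b by ring] using
    measure_univ_le_two_mul_distribFun hf hb le_rfl havg hosc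

end Oscillation

/-! ### The John–Nirenberg inequality -/

section JohnNirenberg

variable {X ι : Type*} [MeasurableSpace X] {c : ℕ → X → ι} {μ : Measure X}
  {f : X → ℝ} {P : Set X} {B D l : ℝ}

theorem cell_inter_maximalSet_subset (hc : IsNestedPartition c) {l' : ℝ} {k : ℕ} {x : X}
    (hl : l ≤ l') (hmin : ∀ i < k, ¬ (cell c i x ⊆ P ∧ l < |⨍ z in cell c i x, f z ∂μ|)) :
    cell c k x ∩ maximalSet c μ f P l' ⊆ maximalSet c μ f (cell c k x) l' := by
  rintro y ⟨hy, i, hi, hlt⟩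
  have hki : k ≤ i := by
    by_contra! hik
    refine hmin i hik ?_
    rw [← cell_eq_of_mem (hc.cell_subset_cell hik.le hy)]
    exact ⟨hi, hl.trans_lt hlt⟩
  exact ⟨i, (hc.cell_subset_cell hki).trans (cell_eq_of_mem hy).subset, hlt⟩

/-- The average over a maximal cell exceeds the threshold by a bounded amount only, because the
average over its parent does not exceed the threshold. -/
theorem abs_average_cell_le_of_maximal (hc : IsNestedPartition c) {x₀ : X}
    (hP : μ (cell c 0 x₀) ≠ ⊤) (hf : IntegrableOn f (cell c 0 x₀) μ) (hD : 0 ≤ D) (hB : 0 ≤ B)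
    (hosc : MeanOscillationLE c μ f (cell c 0 x₀) B)
    (hdoubl : ∀ k x, μ (cell c k x) ≤ ENNReal.ofReal D * μ (cell c (k + 1) x))
    (h0 : |⨍ z in cell c 0 x₀, f z ∂μ| ≤ l) {k : ℕ} {x : X} (hsub : cell c k x ⊆ cell c 0 x₀)
    (hmin : ∀ i < k, ¬ (cell c i x ⊆ cell c 0 x₀ ∧ l < |⨍ z in cell c i x, f z ∂μ|))
    (hne : μ (cell c k x) ≠ 0) :
    |⨍ z in cell c k x, f z ∂μ| ≤ l + D * B := by
  have hroot : cell c 0 x = cell c 0 x₀ := cell_eq_of_mem (hsub mem_cell_self)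
  rcases k with _ | k
  · rw [hroot]
    exact h0.trans (le_add_of_nonneg_right (mul_nonneg hD hB))
  have hparent : cell c k x ⊆ cell c 0 x₀ := hroot ▸ hc.cell_subset_cell k.zero_le
  have hparent_le : |⨍ z in cell c k x, f z ∂μ| ≤ l :=
    not_lt.1 fun h => hmin k k.lt_succ_self ⟨hparent, h⟩
  set a := ⨍ z in cell c k x, f z ∂μ
  have hfin : μ (cell c (k + 1) x) ≠ ⊤ := measure_ne_top_of_subset hsub hP
  have : IsFiniteMeasure (μ.restrict (cell c (k + 1) x)) := isFiniteMeasure_restrict.2 hfin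
  have hdiff : ‖(⨍ z in cell c (k + 1) x, f z ∂μ) - a‖ₑ * μ (cell c (k + 1) x) ≤
      ENNReal.ofReal (D * B) * μ (cell c (k + 1) x) := by
    calc _ ≤ ∫⁻ y in cell c (k + 1) x, ‖f y - a‖ₑ ∂μ := by
          simpa only [Measure.restrict_apply_univ] using
            enorm_average_sub_mul_measure_univ_le (hf.mono_set hsub) a
      _ ≤ ∫⁻ y in cell c k x, ‖f y - a‖ₑ ∂μ :=
        lintegral_mono_set (hc.cell_subset_cell k.le_succ)
      _ ≤ ENNReal.ofReal B * μ (cell c k x) := hosc k x hparent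
      _ ≤ ENNReal.ofReal B * (ENNReal.ofReal D * μ (cell c (k + 1) x)) := by
        gcongr
        exact hdoubl k x
      _ = ENNReal.ofReal (D * B) * μ (cell c (k + 1) x) := by
        rw [← mul_assoc, mul_comm D B, ENNReal.ofReal_mul hB]
  have hclose : |(⨍ z in cell c (k + 1) x, f z ∂μ) - a| ≤ D * B := by
    rw [← ENNReal.ofReal_le_ofReal_iff (mul_nonneg hD hB), ← Real.enorm_eq_ofReal_abs]
    exact (ENNReal.mul_le_mul_iff_left hne hfin).1 hdiff
  linarith [abs_sub_abs_le_abs_sub (⨍ z in cell c (k + 1) x, f z ∂μ) a]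

variable [Countable ι]

theorem measure_maximalSet_le (hc : IsNestedPartition c) (hP : μ P ≠ ⊤)
    (hf : IntegrableOn f P μ) (hB : 0 < B)
    (hosc : MeanOscillationLE c μ f P B) (hl : 4 * B ≤ l) :
    μ (maximalSet c μ f P l) ≤ 2 * distribFun f (μ.restrict P) (l / 2) := by
  set ν : Measure X := (2 : ℝ≥0∞) • (μ.restrict P).restrict {x | l / 2 < |f x|}
  refine (hc.measure_exists_cell_le (ν₂ := ν) (fun R => R ⊆ P ∧ l < |⨍ z in R, f z ∂μ|) ?_).trans ?_
  · rintro k x ⟨hsub, hlt⟩ -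
    have : IsFiniteMeasure (μ.restrict (cell c k x)) :=
      isFiniteMeasure_restrict.2 (measure_ne_top_of_subset hsub hP)
    have hlarge := measure_univ_le_two_mul_distribFun (hf.mono_set hsub).aestronglyMeasurable hB hl
      hlt (by simpa only [Measure.restrict_apply_univ] using hosc k x hsub)
    rw [Measure.restrict_apply_univ, distribFun, Measure.restrict_apply' hc.measurableSet_cell,
      Set.inter_comm] at hlarge
    rw [Measure.smul_apply, smul_eq_mul, Measure.restrict_apply hc.measurableSet_cell]
    refine hlarge.trans ?_
    gcongr 2 * ?_
    exact (measure_mono (Set.subset_inter subset_rfl (Set.inter_subset_left.trans hsub))).trans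
      (Measure.le_restrict_apply _ _)
  · calc ν _ ≤ ν Set.univ := measure_mono (Set.subset_univ _)
      _ = 2 * distribFun f (μ.restrict P) (l / 2) := by
        rw [Measure.smul_apply, Measure.restrict_apply_univ, smul_eq_mul, distribFun]

theorem two_mul_measure_maximalSet_le_of_abs_average_le (hc : IsNestedPartition c) (hP : μ P ≠ ⊤)
    (hf : IntegrableOn f P μ) (hB : 0 < B)
    (hosc : ∫⁻ y in P, ‖f y - ⨍ z in P, f z ∂μ‖ₑ ∂μ ≤ ENNReal.ofReal B * μ P)
    (havg : |⨍ z in P, f z ∂μ| ≤ l) :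
    2 * μ (maximalSet c μ f P (l + 2 * B)) ≤ μ P := by
  set a := ⨍ z in P, f z ∂μ
  set ν : Measure X := (μ.restrict P).withDensity fun y => ‖f y - a‖ₑ
  have hmaximal : (ENNReal.ofReal (2 * B) • μ) (maximalSet c μ f P (l + 2 * B)) ≤
      ν (maximalSet c μ f P (l + 2 * B)) := by
    refine hc.measure_exists_cell_le (fun R => R ⊆ P ∧ l + 2 * B < |⨍ z in R, f z ∂μ|) ?_
    rintro k x ⟨hsub, hlt⟩ -
    have : IsFiniteMeasure (μ.restrict (cell c k x)) :=
      isFiniteMeasure_restrict.2 (measure_ne_top_of_subset hsub hP)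
    have hfar : 2 * B ≤ |(⨍ z in cell c k x, f z ∂μ) - a| := by
      linarith [abs_sub_abs_le_abs_sub (⨍ z in cell c k x, f z ∂μ) a]
    calc (ENNReal.ofReal (2 * B) • μ) (cell c k x)
        ≤ ‖(⨍ z in cell c k x, f z ∂μ) - a‖ₑ * μ (cell c k x) := by
          rw [Measure.smul_apply, smul_eq_mul, Real.enorm_eq_ofReal_abs]
          gcongr
      _ ≤ ∫⁻ y in cell c k x, ‖f y - a‖ₑ ∂μ := by
          simpa only [Measure.restrict_apply_univ] using
            enorm_average_sub_mul_measure_univ_le (hf.mono_set hsub) a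
      _ = ν (cell c k x) := by
          rw [withDensity_apply _ hc.measurableSet_cell,
            Measure.restrict_restrict hc.measurableSet_cell, Set.inter_eq_left.2 hsub]
  have hscaled : ENNReal.ofReal B * (2 * μ (maximalSet c μ f P (l + 2 * B))) ≤
      ENNReal.ofReal B * μ P := by
    calc _ = (ENNReal.ofReal (2 * B) • μ) (maximalSet c μ f P (l + 2 * B)) := by
          rw [Measure.smul_apply, smul_eq_mul, mul_comm 2 B, ENNReal.ofReal_mul hB.le,
            ENNReal.ofReal_ofNat, mul_assoc]
      _ ≤ ν Set.univ := hmaximal.trans (measure_mono (Set.subset_univ _))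
      _ = ∫⁻ y in P, ‖f y - a‖ₑ ∂μ := by
          rw [withDensity_apply _ MeasurableSet.univ, Measure.restrict_univ]
      _ ≤ ENNReal.ofReal B * μ P := hosc
  exact (ENNReal.mul_le_mul_iff_right (by simpa using hB) ENNReal.ofReal_ne_top).1 hscaled

theorem two_mul_measure_maximalSet_le (hc : IsNestedPartition c) {x₀ : X}
    (hP : μ (cell c 0 x₀) ≠ ⊤) (hf : IntegrableOn f (cell c 0 x₀) μ) (hD : 0 ≤ D) (hB : 0 < B)
    (hosc : MeanOscillationLE c μ f (cell c 0 x₀) B)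
    (hdoubl : ∀ k x, μ (cell c k x) ≤ ENNReal.ofReal D * μ (cell c (k + 1) x))
    (h0 : |⨍ z in cell c 0 x₀, f z ∂μ| ≤ l) :
    2 * μ (maximalSet c μ f (cell c 0 x₀) (l + D * B + 2 * B)) ≤
      μ (maximalSet c μ f (cell c 0 x₀) l) := by
  set l' := l + D * B + 2 * B
  have hl : l ≤ l' := by
    have := mul_nonneg hD hB.le
    linarith
  set E' := maximalSet c μ f (cell c 0 x₀) l'
  have hE' : MeasurableSet E' :=
    hc.measurableSet_exists_cell fun R => R ⊆ cell c 0 x₀ ∧ l' < |⨍ z in R, f z ∂μ|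
  have hmaximal : ((2 : ℝ≥0∞) • μ.restrict E') (maximalSet c μ f (cell c 0 x₀) l) ≤
      μ (maximalSet c μ f (cell c 0 x₀) l) := by
    refine hc.measure_exists_cell_le
      (fun R => R ⊆ cell c 0 x₀ ∧ l < |⨍ z in R, f z ∂μ|) ?_
    rintro k x ⟨hsub, -⟩ hmin
    rw [Measure.smul_apply, smul_eq_mul, Measure.restrict_apply' hE']
    rcases eq_or_ne (μ (cell c k x)) 0 with hzero | hne
    · rw [measure_mono_null Set.inter_subset_left hzero, mul_zero]
      exact zero_le
    calc 2 * μ (cell c k x ∩ E') ≤ 2 * μ (maximalSet c μ f (cell c k x) l') := by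
          gcongr
          exact cell_inter_maximalSet_subset hc hl hmin
      _ ≤ μ (cell c k x) :=
          two_mul_measure_maximalSet_le_of_abs_average_le hc (measure_ne_top_of_subset hsub hP)
            (hf.mono_set hsub) hB (hosc k x hsub)
            (abs_average_cell_le_of_maximal hc hP hf hD hB.le hosc hdoubl h0 hsub hmin hne)
  have hsub : E' ⊆ maximalSet c μ f (cell c 0 x₀) l :=
    fun _ ⟨k, hk, hlt⟩ => (⟨k, hk, hl.trans_lt hlt⟩ : ∃ k, _)
  rwa [Measure.smul_apply, smul_eq_mul, Measure.restrict_apply' hE',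
    Set.inter_eq_right.2 hsub] at hmaximal

theorem two_pow_mul_distribFun_le (hc : IsNestedPartition c) {x₀ : X}
    (hP : μ (cell c 0 x₀) ≠ ⊤) (hf : IntegrableOn f (cell c 0 x₀) μ) (hD : 0 ≤ D) (hB : 0 < B)
    (hosc : MeanOscillationLE c μ f (cell c 0 x₀) B)
    (hdoubl : ∀ k x, μ (cell c k x) ≤ ENNReal.ofReal D * μ (cell c (k + 1) x))
    (h0 : |⨍ z in cell c 0 x₀, f z ∂μ| ≤ 4 * B)
    (hlim : ∀ᵐ x ∂μ, Tendsto (fun k => ⨍ z in cell c k x, f z ∂μ) atTop (𝓝 (f x))) (m : ℕ) :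
    2 ^ m * distribFun f (μ.restrict (cell c 0 x₀)) (B * (4 + m * (D + 2))) ≤
      2 * distribFun f (μ.restrict (cell c 0 x₀)) (2 * B) := by
  have hmax : 2 ^ m * μ (maximalSet c μ f (cell c 0 x₀) (B * (4 + m * (D + 2)))) ≤
      2 * distribFun f (μ.restrict (cell c 0 x₀)) (2 * B) := by
    induction m with
    | zero =>
      have hle := measure_maximalSet_le hc hP hf hB hosc le_rfl
      rw [show 4 * B / 2 = 2 * B by ring] at hle
      simpa [mul_comm B] using hle
    | succ m ih =>
      refine le_trans ?_ ih
      rw [pow_succ, mul_assoc]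
      gcongr
      have hthreshold : 4 * B ≤ B * (4 + m * (D + 2)) := by
        linarith [show 0 ≤ B * (m * (D + 2)) by positivity]
      have hle := two_mul_measure_maximalSet_le hc hP hf hD hB hosc hdoubl (h0.trans hthreshold)
      rwa [show B * (4 + m * (D + 2)) + D * B + 2 * B = B * (4 + (m + 1 : ℕ) * (D + 2)) by
        push_cast; ring] at hle
  refine le_trans ?_ hmax
  gcongr
  rw [distribFun, Measure.restrict_apply' hc.measurableSet_cell]
  refine measure_mono_ae ?_
  filter_upwards [hlim] with x hx ⟨hlt, hmem⟩
  obtain ⟨k, hk⟩ := (hx.abs.eventually (lt_mem_nhds hlt)).exists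
  change ∃ k, _ ∧ _
  refine ⟨k, ?_, hk⟩
  rw [← cell_eq_of_mem hmem]
  exact hc.cell_subset_cell k.zero_le

/-- The decay rate in the John–Nirenberg inequality for nested partitions whose cells lose at most
a factor `D` of their measure in each refinement. -/
noncomputable def johnNirenbergRate (D : ℝ) : ℝ :=
  Real.log 2 / (D + 2)

theorem johnNirenbergRate_pos {D : ℝ} (hD : 0 ≤ D) : 0 < johnNirenbergRate D :=
  div_pos (Real.log_pos one_lt_two) (by linarith)

theorem two_le_four_mul_exp_mul_two_pow_floor (D t : ℝ) :
    2 ≤ 4 * Real.exp (-(johnNirenbergRate D * t)) * 2 ^ ⌊t / (D + 2)⌋₊ := by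
  set m := ⌊t / (D + 2)⌋₊
  have hrate : johnNirenbergRate D * t ≤ Real.log 2 * (m + 1) := by
    rw [johnNirenbergRate, div_mul_comm, mul_comm]
    exact mul_le_mul_of_nonneg_left (Nat.lt_floor_add_one (t / (D + 2))).le
      (Real.log_nonneg one_le_two)
  have hpow : Real.exp (Real.log 2 * (m + 1)) = 2 * 2 ^ m := by
    rw [← Real.rpow_def_of_pos two_pos, Real.rpow_add_one two_ne_zero, Real.rpow_natCast,
      mul_comm]
  have hle : Real.exp (johnNirenbergRate D * t) ≤ 2 * 2 ^ m := hpow ▸ Real.exp_le_exp.2 hrate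
  rw [Real.exp_neg, mul_right_comm, ← div_eq_mul_inv, le_div_iff₀ (Real.exp_pos _)]
  linarith

/-- Unlike in the usual form of the inequality, the right-hand side involves the distribution
function instead of the measure of the root cell; this allows exhausting a space of infinite
measure. -/
theorem distribFun_le_exp_mul_distribFun (hc : IsNestedPartition c) {x₀ : X}
    (hP : μ (cell c 0 x₀) ≠ ⊤) (hf : IntegrableOn f (cell c 0 x₀) μ) (hD : 0 ≤ D) (hB : 0 < B)
    (hosc : MeanOscillationLE c μ f (cell c 0 x₀) B)
    (hdoubl : ∀ k x, μ (cell c k x) ≤ ENNReal.ofReal D * μ (cell c (k + 1) x))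
    (h0 : |⨍ z in cell c 0 x₀, f z ∂μ| ≤ 4 * B)
    (hlim : ∀ᵐ x ∂μ, Tendsto (fun k => ⨍ z in cell c k x, f z ∂μ) atTop (𝓝 (f x))) {α : ℝ}
    (hα : 4 ≤ α) :
    distribFun f (μ.restrict (cell c 0 x₀)) (B * α) ≤
      ENNReal.ofReal (4 * Real.exp (-(johnNirenbergRate D * (α - 4)))) *
        distribFun f (μ.restrict (cell c 0 x₀)) (2 * B) := by
  set d := distribFun f (μ.restrict (cell c 0 x₀))
  set m := ⌊(α - 4) / (D + 2)⌋₊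
  have hm : 4 + m * (D + 2) ≤ α := by
    have hfloor : (m : ℝ) ≤ (α - 4) / (D + 2) :=
      Nat.floor_le (div_nonneg (by linarith) (by linarith))
    rw [le_div_iff₀ (by linarith)] at hfloor
    linarith
  have hexp : 2 ≤ 4 * Real.exp (-(johnNirenbergRate D * (α - 4))) * 2 ^ m :=
    two_le_four_mul_exp_mul_two_pow_floor D (α - 4)
  have h2m : (2 : ℝ≥0∞) ^ m * d (B * α) ≤ 2 * d (2 * B) := by
    refine le_trans ?_ (two_pow_mul_distribFun_le hc hP hf hD hB hosc hdoubl h0 hlim m)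
    gcongr
    exact measure_mono fun x hx => lt_of_le_of_lt (mul_le_mul_of_nonneg_left hm hB.le) hx
  refine (ENNReal.mul_le_mul_iff_right (pow_ne_zero m two_ne_zero)
    (ENNReal.pow_ne_top ENNReal.ofNat_ne_top)).1 (h2m.trans ?_)
  calc 2 * d (2 * B)
      ≤ ENNReal.ofReal (4 * Real.exp (-(johnNirenbergRate D * (α - 4))) * 2 ^ m) * d (2 * B) := by
        gcongr
        simpa using ENNReal.ofReal_le_ofReal hexp
    _ = _ := by
        rw [ENNReal.ofReal_mul' (by positivity), ENNReal.ofReal_pow zero_le_two,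
          ENNReal.ofReal_ofNat, mul_assoc, mul_left_comm]

end JohnNirenberg

/-! ### Weak quasi-norms and the layer cake formula -/

section WeakNorm

variable {X : Type*} [MeasurableSpace X] {μ ν : Measure X} {f : X → ℝ} {q p : ℝ}

theorem distribFun_le_weakLpNorm_rpow_mul (hq : 0 < q) {α : ℝ} (hα : 0 < α) :
    distribFun f μ α ≤ weakLpNorm f q μ ^ q * ENNReal.ofReal (α ^ (-q)) := by
  have hpow : ENNReal.ofReal (α ^ q) ≠ 0 := by simpa using Real.rpow_pos_of_pos hα q
  have hroot : (distribFun f μ α * ENNReal.ofReal (α ^ q)) ^ q⁻¹ ≤ weakLpNorm f q μ := by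
    refine le_iInf₂ fun C ⟨hC, hadm⟩ => ?_
    rw [ENNReal.rpow_inv_le_iff hq, ENNReal.ofReal_rpow_of_pos hC,
      ← ENNReal.le_div_iff_mul_le (.inl hpow) (.inl ENNReal.ofReal_ne_top),
      ← ENNReal.ofReal_div_of_pos (Real.rpow_pos_of_pos hα q)]
    exact hadm α hα
  rwa [ENNReal.rpow_inv_le_iff hq,
    ← ENNReal.le_div_iff_mul_le (.inl hpow) (.inl ENNReal.ofReal_ne_top), ENNReal.div_eq_inv_mul,
    ← ENNReal.ofReal_inv_of_pos (Real.rpow_pos_of_pos hα q), ← Real.rpow_neg hα.le,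
    mul_comm] at hroot

theorem weakLpNorm_mono_measure (h : μ ≤ ν) : weakLpNorm f q μ ≤ weakLpNorm f q ν :=
  iInf_mono fun _ => iInf_mono' fun ⟨hC, hadm⟩ =>
    ⟨⟨hC, fun α hα => (h _).trans (hadm α hα)⟩, le_rfl⟩

theorem weakLpNorm_indicator {s : Set X} (hs : MeasurableSet s) :
    weakLpNorm (s.indicator f) q μ = weakLpNorm f q (μ.restrict s) := by
  have hdistrib : ∀ α : ℝ, 0 < α →
      distribFun (s.indicator f) μ α = distribFun f (μ.restrict s) α := by
    intro α hα
    rw [distribFun, distribFun, Measure.restrict_apply' hs]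
    congr 1
    ext x
    by_cases hx : x ∈ s <;> simp [hx, hα.le]
  refine iInf_congr fun C => iInf_congr_Prop (and_congr_right fun _ => ?_) fun _ => rfl
  exact forall₂_congr fun α hα => by rw [hdistrib α hα]

theorem weakLpNorm_le_eLpNorm (hp : 0 < p) (hf : AEStronglyMeasurable f μ) :
    weakLpNorm f p μ ≤ eLpNorm f (ENNReal.ofReal p) μ := by
  refine le_of_forall_gt_imp_ge_of_dense fun c hc => ?_
  rcases eq_or_ne c ⊤ with rfl | hct
  · exact le_top
  have hc0 : 0 < c.toReal := ENNReal.toReal_pos (pos_of_gt hc).ne' hct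
  refine (iInf₂_le c.toReal ⟨hc0, fun α hα => ?_⟩).trans_eq (ENNReal.ofReal_toReal hct)
  have hcheb := mul_meas_ge_le_pow_eLpNorm' μ (by simpa using hp) ENNReal.ofReal_ne_top hf
    (ENNReal.ofReal α)
  rw [ENNReal.toReal_ofReal hp.le, ENNReal.ofReal_rpow_of_pos hα] at hcheb
  rw [ENNReal.ofReal_div_of_pos (Real.rpow_pos_of_pos hα p), ENNReal.le_div_iff_mul_le
    (.inl (by simpa using Real.rpow_pos_of_pos hα p)) (.inl ENNReal.ofReal_ne_top), mul_comm]
  calc ENNReal.ofReal (α ^ p) * distribFun f μ α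
      ≤ ENNReal.ofReal (α ^ p) * μ {x | ENNReal.ofReal α ≤ ‖f x‖ₑ} := by
        gcongr
        refine measure_mono fun x hx => ?_
        rw [Set.mem_ofPred_eq, Real.enorm_eq_ofReal_abs]
        exact ENNReal.ofReal_le_ofReal (le_of_lt hx)
    _ ≤ eLpNorm f (ENNReal.ofReal p) μ ^ p := hcheb
    _ ≤ c ^ p := by gcongr
    _ = ENNReal.ofReal (c.toReal ^ p) := by
        rw [← ENNReal.ofReal_rpow_of_pos hc0, ENNReal.ofReal_toReal hct]

theorem setLIntegral_rpow_sub_one_mul_le {d : ℝ → ℝ≥0∞} {M : ℝ≥0∞} (hM : M ≠ ⊤) (hqp : q < p)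
    (hd : ∀ t, 0 < t → d t ≤ M * ENNReal.ofReal (t ^ (-q))) :
    ∫⁻ t in Set.Ioc (0 : ℝ) 1, d t * ENNReal.ofReal (t ^ (p - 1)) ≤
      M * ENNReal.ofReal (1 / (p - q)) := by
  have hint : IntegrableOn (fun t : ℝ => t ^ (p - q - 1)) (Set.Ioc 0 1) :=
    (intervalIntegral.intervalIntegrable_rpow' (by linarith)).1
  have hval : ∫ t in Set.Ioc (0 : ℝ) 1, t ^ (p - q - 1) = 1 / (p - q) := by
    rw [← intervalIntegral.integral_of_le zero_le_one, integral_rpow (.inl (by linarith)),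
      sub_add_cancel, Real.one_rpow, Real.zero_rpow (sub_pos.2 hqp).ne', sub_zero]
  rw [← hval, ofReal_integral_eq_lintegral_ofReal hint
    ((ae_restrict_mem measurableSet_Ioc).mono fun t ht => Real.rpow_nonneg ht.1.le _),
    ← lintegral_const_mul' _ _ hM]
  refine setLIntegral_mono' measurableSet_Ioc fun t ht => ?_
  calc d t * ENNReal.ofReal (t ^ (p - 1))
      ≤ M * ENNReal.ofReal (t ^ (-q)) * ENNReal.ofReal (t ^ (p - 1)) := by
        gcongr
        exact hd t ht.1
    _ = M * ENNReal.ofReal (t ^ (p - q - 1)) := by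
        rw [mul_assoc, ← ENNReal.ofReal_mul (Real.rpow_nonneg ht.1.le _), ← Real.rpow_add ht.1,
          show -q + (p - 1) = p - q - 1 by ring]

theorem setLIntegral_exp_mul_rpow_sub_one_le {d : ℝ → ℝ≥0∞} {M : ℝ≥0∞} {A b : ℝ} (hM : M ≠ ⊤)
    (hp : 0 < p) (hA : 0 ≤ A) (hb : 0 < b)
    (hd : ∀ t, 1 ≤ t → d t ≤ M * ENNReal.ofReal (A * Real.exp (-(b * t)))) :
    ∫⁻ t in Set.Ioi (1 : ℝ), d t * ENNReal.ofReal (t ^ (p - 1)) ≤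
      M * ENNReal.ofReal (A * ((1 / b) ^ p * Real.Gamma p)) := by
  have hint : Integrable (fun t : ℝ => A * (t ^ (p - 1) * Real.exp (-(b * t))))
      (volume.restrict (Set.Ioi 0)) := by
    simpa only [Real.rpow_one, neg_mul] using
      (integrableOn_rpow_mul_exp_neg_mul_rpow (by linarith) one_pos hb).const_mul A
  rw [← Real.integral_rpow_mul_exp_neg_mul_Ioi hp hb, ← integral_const_mul,
    ofReal_integral_eq_lintegral_ofReal hint
      ((ae_restrict_mem measurableSet_Ioi).mono fun t ht => by
        have := Real.rpow_nonneg (le_of_lt ht) (p - 1)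
        positivity),
    ← lintegral_const_mul' _ _ hM]
  refine (setLIntegral_mono' measurableSet_Ioi fun t ht => ?_).trans
    (lintegral_mono_set (Set.Ioi_subset_Ioi zero_le_one))
  calc d t * ENNReal.ofReal (t ^ (p - 1))
      ≤ M * ENNReal.ofReal (A * Real.exp (-(b * t))) * ENNReal.ofReal (t ^ (p - 1)) := by
        gcongr
        exact hd t (le_of_lt ht)
    _ = M * ENNReal.ofReal (A * (t ^ (p - 1) * Real.exp (-(b * t)))) := by
        rw [mul_assoc, ← ENNReal.ofReal_mul (by positivity), mul_right_comm, ← mul_assoc]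

theorem lintegral_enorm_rpow_eq_lintegral_distribFun (hf : AEMeasurable f μ) (hp : 0 < p) :
    ∫⁻ x, ‖f x‖ₑ ^ p ∂μ = ENNReal.ofReal p *
      ∫⁻ t in Set.Ioi (0 : ℝ), distribFun f μ t * ENNReal.ofReal (t ^ (p - 1)) := by
  unfold distribFun
  rw [← lintegral_rpow_eq_lintegral_meas_lt_mul μ (.of_forall fun x => abs_nonneg (f x))
    (by fun_prop) hp]
  refine lintegral_congr fun x => ?_
  rw [Real.enorm_eq_ofReal_abs, ENNReal.ofReal_rpow_of_nonneg (abs_nonneg _) hp.le]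

theorem lintegral_enorm_rpow_le_of_exp_decay (hf : AEMeasurable f μ) {M : ℝ≥0∞} {A b : ℝ}
    (hM : M ≠ ⊤) (hp : 0 < p) (hqp : q < p) (hA : 0 ≤ A) (hb : 0 < b)
    (hweak : ∀ α, 0 < α → distribFun f μ α ≤ M * ENNReal.ofReal (α ^ (-q)))
    (hexp : ∀ α, 1 ≤ α → distribFun f μ α ≤ M * ENNReal.ofReal (A * Real.exp (-(b * α)))) :
    ∫⁻ x, ‖f x‖ₑ ^ p ∂μ ≤
      M * ENNReal.ofReal (p * (1 / (p - q) + A * ((1 / b) ^ p * Real.Gamma p))) := by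
  have : 0 < p - q := sub_pos.2 hqp
  rw [lintegral_enorm_rpow_eq_lintegral_distribFun hf hp, ← Set.Ioc_union_Ioi_eq_Ioi zero_le_one,
    ENNReal.ofReal_mul hp.le, ENNReal.ofReal_add (by positivity) (by positivity), mul_left_comm,
    mul_add]
  gcongr
  exact (lintegral_union_le _ _ _).trans (add_le_add (setLIntegral_rpow_sub_one_mul_le hM hqp hweak)
    (setLIntegral_exp_mul_rpow_sub_one_le hM hp hA hb hexp))

/-- The constant in the interpolation between `L^{q,∞}` and `L^p` for a function whose distribution
function decays exponentially with rate `b` above four times its mean oscillation. -/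
noncomputable def expDecayConst (q p b : ℝ) : ℝ :=
  p * (1 / (p - q) + 4 * Real.exp (4 * b) * ((1 / b) ^ p * Real.Gamma p))

theorem expDecayConst_nonneg {b : ℝ} (hp : 0 < p) (hqp : q < p) (hb : 0 < b) :
    0 ≤ expDecayConst q p b := by
  have : 0 < p - q := sub_pos.2 hqp
  unfold expDecayConst
  positivity

theorem distribFun_div_eq {B : ℝ} (hB : 0 < B) (α : ℝ) :
    distribFun (fun x => f x / B) μ α = distribFun f μ (B * α) := by
  unfold distribFun
  congr 1
  ext x
  rw [Set.mem_ofPred_eq, Set.mem_ofPred_eq, abs_div, abs_of_pos hB, lt_div_iff₀' hB]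

theorem lintegral_enorm_rpow_eq_mul_lintegral_div (f : X → ℝ) (hp : 0 ≤ p) {B : ℝ} (hB : 0 < B) :
    ∫⁻ x, ‖f x‖ₑ ^ p ∂μ = ENNReal.ofReal (B ^ p) * ∫⁻ x, ‖f x / B‖ₑ ^ p ∂μ := by
  rw [← lintegral_const_mul' _ _ ENNReal.ofReal_ne_top]
  refine lintegral_congr fun x => ?_
  rw [← ENNReal.ofReal_rpow_of_pos hB, ← ENNReal.mul_rpow_of_nonneg _ _ hp,
    ← Real.enorm_eq_ofReal hB.le, ← enorm_mul, mul_div_cancel₀ _ hB.ne']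

theorem le_mul_exp_of_le_of_exp_decay {d : ℝ → ℝ≥0∞} {M : ℝ≥0∞} {b : ℝ} (hb : 0 ≤ b)
    (hle : ∀ α, 1 ≤ α → d α ≤ M)
    (hexp : ∀ α, 4 ≤ α → d α ≤ ENNReal.ofReal (4 * Real.exp (-(b * (α - 4)))) * d 2) {α : ℝ}
    (hα : 1 ≤ α) :
    d α ≤ M * ENNReal.ofReal (4 * Real.exp (4 * b) * Real.exp (-(b * α))) := by
  have hfactor : 4 * Real.exp (4 * b) * Real.exp (-(b * α)) =
      4 * Real.exp (-(b * (α - 4))) := by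
    rw [mul_assoc, ← Real.exp_add]
    ring_nf
  rw [hfactor]
  rcases le_total 4 α with h4 | h4
  · refine (hexp α h4).trans ?_
    rw [mul_comm]
    gcongr
    exact hle 2 one_le_two
  · refine (hle α hα).trans (le_mul_of_one_le_right' (ENNReal.one_le_ofReal.2 ?_))
    have : 1 ≤ Real.exp (-(b * (α - 4))) := Real.one_le_exp (by nlinarith)
    linarith

theorem lintegral_enorm_rpow_le_weakLpNorm_rpow_mul (hf : AEMeasurable f μ)
    (hw : weakLpNorm f q μ ≠ ⊤) (hq : 0 < q) (hqp : q < p) {B b : ℝ} (hB : 0 < B) (hb : 0 < b)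
    (hexp : ∀ α, 4 ≤ α → distribFun f μ (B * α) ≤
      ENNReal.ofReal (4 * Real.exp (-(b * (α - 4)))) * distribFun f μ (2 * B)) :
    ∫⁻ x, ‖f x‖ₑ ^ p ∂μ ≤
      weakLpNorm f q μ ^ q * ENNReal.ofReal (expDecayConst q p b * B ^ (p - q)) := by
  have hp : 0 < p := hq.trans hqp
  set M := weakLpNorm f q μ ^ q * ENNReal.ofReal (B ^ (-q))
  have hM : M ≠ ⊤ :=
    ENNReal.mul_ne_top (ENNReal.rpow_ne_top_of_nonneg hq.le hw) ENNReal.ofReal_ne_top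
  have hweak : ∀ α, 0 < α → distribFun f μ (B * α) ≤ M * ENNReal.ofReal (α ^ (-q)) := by
    intro α hα
    refine (distribFun_le_weakLpNorm_rpow_mul hq (mul_pos hB hα)).trans_eq ?_
    rw [Real.mul_rpow hB.le hα.le, ENNReal.ofReal_mul (by positivity), mul_assoc]
  have hle : ∀ α, 1 ≤ α → distribFun f μ (B * α) ≤ M := fun α hα => by
    refine (hweak α (by linarith)).trans (mul_le_of_le_one_right' (ENNReal.ofReal_le_one.2 ?_))
    exact Real.rpow_le_one_of_one_le_of_nonpos hα (by linarith)
  have hexp' : ∀ α, 1 ≤ α → distribFun f μ (B * α) ≤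
      M * ENNReal.ofReal (4 * Real.exp (4 * b) * Real.exp (-(b * α))) := fun α =>
    le_mul_exp_of_le_of_exp_decay (d := fun α => distribFun f μ (B * α)) hb.le hle
      fun α hα => by simpa only [mul_comm B 2] using hexp α hα
  have hrescaled := lintegral_enorm_rpow_le_of_exp_decay (hf.div_const B) hM hp hqp (by positivity)
    hb (fun α hα => (distribFun_div_eq hB α).trans_le (hweak α hα))
    (fun α hα => (distribFun_div_eq hB α).trans_le (hexp' α hα))
  calc ∫⁻ x, ‖f x‖ₑ ^ p ∂μ
      = ENNReal.ofReal (B ^ p) * ∫⁻ x, ‖f x / B‖ₑ ^ p ∂μ :=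
        lintegral_enorm_rpow_eq_mul_lintegral_div f hp.le hB
    _ ≤ ENNReal.ofReal (B ^ p) * (M * ENNReal.ofReal (expDecayConst q p b)) := by
        gcongr
        exact hrescaled
    _ = weakLpNorm f q μ ^ q * ENNReal.ofReal (expDecayConst q p b * B ^ (p - q)) := by
        rw [mul_left_comm, ENNReal.ofReal_mul (expDecayConst_nonneg hp hqp hb),
          sub_eq_add_neg, Real.rpow_add hB, ENNReal.ofReal_mul (by positivity)]
        ring

theorem le_mul_rpow_of_forall_le_ofReal {x w b : ℝ≥0∞} {r : ℝ} (hw : w ≠ ⊤) (hb : b ≠ ⊤)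
    (h : ∀ B : ℝ, 0 < B → b ≤ ENNReal.ofReal B → x ≤ w * ENNReal.ofReal B ^ r) :
    x ≤ w * b ^ r := by
  have : (𝓝[>] b).NeBot := nhdsGT_neBot_of_exists_gt ⟨⊤, hb.lt_top⟩
  have hlim : Tendsto (fun B => w * B ^ r) (𝓝[>] b) (𝓝 (w * b ^ r)) :=
    (ENNReal.Tendsto.const_mul (ENNReal.continuous_rpow_const.tendsto b) (.inr hw)).mono_left
      nhdsWithin_le_nhds
  refine ge_of_tendsto hlim ?_
  filter_upwards [Ioo_mem_nhdsGT hb.lt_top] with B ⟨hbB, hB⟩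
  have hle := h B.toReal (ENNReal.toReal_pos (pos_of_gt hbB).ne' hB.ne)
  rw [ENNReal.ofReal_toReal hB.ne] at hle
  exact hle hbB.le

theorem ofReal_mul_rpow_mul_rpow_lt_top {w b : ℝ≥0∞} {K : ℝ} (hq : 0 < q) (hqp : q < p)
    (hw : w ≠ ⊤) (hb : b ≠ ⊤) :
    ENNReal.ofReal K * w ^ (q / p) * b ^ (1 - q / p) < ⊤ := by
  have hp : 0 < p := hq.trans hqp
  have hexponent : 0 ≤ 1 - q / p := sub_nonneg.2 ((div_le_one hp).2 hqp.le)
  exact ENNReal.mul_lt_top (ENNReal.mul_lt_top ENNReal.ofReal_lt_top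
    (ENNReal.rpow_lt_top_of_nonneg (by positivity) hw)) (ENNReal.rpow_lt_top_of_nonneg hexponent hb)

theorem memLp_and_eLpNorm_le_of_forall_lintegral_enorm_rpow_le (hf : AEStronglyMeasurable f μ)
    {w b : ℝ≥0∞} {K : ℝ} (hq : 0 < q) (hqp : q < p) (hw : w ≠ ⊤) (hb : b ≠ ⊤) (hK : 0 ≤ K)
    (h : ∀ B : ℝ, 0 < B → b ≤ ENNReal.ofReal B →
      ∫⁻ x, ‖f x‖ₑ ^ p ∂μ ≤ w ^ q * ENNReal.ofReal (K * B ^ (p - q))) :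
    MemLp f (ENNReal.ofReal p) μ ∧ eLpNorm f (ENNReal.ofReal p) μ ≤
      ENNReal.ofReal (K ^ (1 / p)) * w ^ (q / p) * b ^ (1 - q / p) := by
  have hp : 0 < p := hq.trans hqp
  have hp' : 0 ≤ 1 / p := by positivity
  have hle : ∫⁻ x, ‖f x‖ₑ ^ p ∂μ ≤ w ^ q * ENNReal.ofReal K * b ^ (p - q) := by
    refine le_mul_rpow_of_forall_le_ofReal (ENNReal.mul_ne_top
      (ENNReal.rpow_ne_top_of_nonneg hq.le hw) ENNReal.ofReal_ne_top) hb fun B hB hbB => ?_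
    rw [ENNReal.ofReal_rpow_of_pos hB, mul_assoc, ← ENNReal.ofReal_mul hK]
    exact h B hB hbB
  have hnorm : eLpNorm f (ENNReal.ofReal p) μ ≤
      ENNReal.ofReal (K ^ (1 / p)) * w ^ (q / p) * b ^ (1 - q / p) := by
    rw [eLpNorm_eq_lintegral_rpow_enorm_toReal (by simpa using hp) ENNReal.ofReal_ne_top,
      ENNReal.toReal_ofReal hp.le]
    calc (∫⁻ x, ‖f x‖ₑ ^ p ∂μ) ^ (1 / p)
        ≤ (w ^ q * ENNReal.ofReal K * b ^ (p - q)) ^ (1 / p) := by gcongr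
      _ = ENNReal.ofReal (K ^ (1 / p)) * w ^ (q / p) * b ^ (1 - q / p) := by
          rw [ENNReal.mul_rpow_of_nonneg _ _ hp', ENNReal.mul_rpow_of_nonneg _ _ hp',
            ← ENNReal.rpow_mul, ← ENNReal.rpow_mul, ENNReal.ofReal_rpow_of_nonneg hK hp',
            mul_one_div, mul_one_div, sub_div, div_self hp.ne', mul_comm (w ^ (q / p))]
  exact ⟨⟨hf, hnorm.trans_lt (ofReal_mul_rpow_mul_rpow_lt_top hq hqp hw hb)⟩, hnorm⟩

end WeakNorm

/-! ### Cubes and the dyadic grid -/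

section Cubes

variable {n : ℕ} {a : EuclideanSpace ℝ (Fin n)} {s : ℝ}

theorem axisCube_eq_preimage_Icc (a : EuclideanSpace ℝ (Fin n)) (s : ℝ) :
    axisCube a s = WithLp.ofLp ⁻¹' Set.Icc (WithLp.ofLp a) fun i => a i + s := by
  ext x
  simp only [axisCube, Set.mem_ofPred_eq, Set.mem_preimage, Set.mem_Icc, Pi.le_def]
  exact forall_and

theorem axisCube_eq_preimage_closedBall (a : EuclideanSpace ℝ (Fin n)) (hs : 0 ≤ s) :
    axisCube a s = WithLp.ofLp ⁻¹' Metric.closedBall (fun i => a i + s / 2) (s / 2) := by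
  ext x
  rw [Set.mem_preimage, closedBall_pi _ (by positivity)]
  simp only [axisCube, Set.mem_ofPred_eq, Set.mem_univ_pi, Real.closedBall_eq_Icc,
    add_sub_cancel_right, add_assoc, add_halves]

theorem isCompact_axisCube (a : EuclideanSpace ℝ (Fin n)) (s : ℝ) : IsCompact (axisCube a s) := by
  rw [axisCube_eq_preimage_Icc]
  exact (EuclideanSpace.equiv (Fin n) ℝ).toHomeomorph.isClosedEmbedding.isCompact_preimage
    isCompact_Icc

theorem measurableSet_axisCube (a : EuclideanSpace ℝ (Fin n)) (s : ℝ) :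
    MeasurableSet (axisCube a s) :=
  (isCompact_axisCube a s).measurableSet

theorem volume_axisCube (a : EuclideanSpace ℝ (Fin n)) (s : ℝ) :
    volume (axisCube a s) = ENNReal.ofReal s ^ n := by
  rw [axisCube_eq_preimage_Icc, (PiLp.volume_preserving_ofLp (Fin n)).measure_preimage
    measurableSet_Icc.nullMeasurableSet, Real.volume_Icc_pi]
  simp

theorem volume_axisCube_ne_zero (a : EuclideanSpace ℝ (Fin n)) (hs : 0 < s) :
    volume (axisCube a s) ≠ 0 := by
  rw [volume_axisCube]
  exact pow_ne_zero _ (by simpa using hs)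

theorem volume_axisCube_ne_top (a : EuclideanSpace ℝ (Fin n)) (s : ℝ) :
    volume (axisCube a s) ≠ ⊤ :=
  (isCompact_axisCube a s).measure_ne_top

/-- The half-open cube with lowest corner `a` and side length `s`; unlike the closed cubes, these
can be subdivided into disjoint dyadic cubes. -/
def halfOpenCube (a : EuclideanSpace ℝ (Fin n)) (s : ℝ) : Set (EuclideanSpace ℝ (Fin n)) :=
  {x | ∀ i, x i ∈ Set.Ico (a i) (a i + s)}

theorem halfOpenCube_eq_preimage (a : EuclideanSpace ℝ (Fin n)) (s : ℝ) :
    halfOpenCube a s = WithLp.ofLp ⁻¹' Set.univ.pi fun i => Set.Ico (a i) (a i + s) := by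
  ext x
  simp [halfOpenCube]

theorem halfOpenCube_ae_eq_axisCube (a : EuclideanSpace ℝ (Fin n)) (s : ℝ) :
    halfOpenCube a s =ᵐ[volume] axisCube a s := by
  rw [halfOpenCube_eq_preimage, axisCube_eq_preimage_Icc]
  exact (PiLp.volume_preserving_ofLp (Fin n)).quasiMeasurePreserving.preimage_ae_eq
    Measure.univ_pi_Ico_ae_eq_Icc

theorem closure_halfOpenCube (a : EuclideanSpace ℝ (Fin n)) (hs : 0 < s) :
    closure (halfOpenCube a s) = axisCube a s := by
  rw [halfOpenCube_eq_preimage, axisCube_eq_preimage_Icc, ← Set.pi_univ_Icc]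
  refine ((EuclideanSpace.equiv (Fin n) ℝ).toHomeomorph.preimage_closure _).symm.trans ?_
  rw [closure_pi_set]
  simp only [closure_Ico (lt_add_of_pos_right _ hs).ne]
  rfl

theorem setAverage_preimage_ofLp (f : EuclideanSpace ℝ (Fin n) → ℝ) (S : Set (Fin n → ℝ)) :
    ⨍ x in WithLp.ofLp ⁻¹' S, f x = ⨍ z in S, f (WithLp.toLp 2 z) := by
  have hmp := PiLp.volume_preserving_ofLp (Fin n)
  have hemb := (MeasurableEquiv.toLp 2 (Fin n → ℝ)).symm.measurableEmbedding
  have hint := hmp.setIntegral_preimage_emb hemb (fun z => f (WithLp.toLp 2 z)) S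
  have hvol := hmp.measure_preimage_emb hemb S
  rw [setAverage_eq, setAverage_eq, ← hint, measureReal_def, measureReal_def, ← hvol]

theorem ae_tendsto_setAverage_axisCube {f : EuclideanSpace ℝ (Fin n) → ℝ}
    (hf : LocallyIntegrable f volume) :
    ∀ᵐ x, ∀ (b : ℕ → EuclideanSpace ℝ (Fin n)) (r : ℕ → ℝ), (∀ k, 0 < r k) →
      Tendsto r atTop (𝓝 0) → (∀ k, x ∈ axisCube (b k) (r k)) →
      Tendsto (fun k => ⨍ y in axisCube (b k) (r k), f y) atTop (𝓝 (f x)) := by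
  have hmp := PiLp.volume_preserving_toLp (Fin n)
  have hcomp : LocallyIntegrable (fun z : Fin n → ℝ => f (WithLp.toLp 2 z)) volume := by
    refine (locallyIntegrable_iff).2 fun K hK => ?_
    have himage : IsCompact (WithLp.toLp 2 '' K : Set (EuclideanSpace ℝ (Fin n))) :=
      hK.image (PiLp.continuous_toLp 2 _)
    refine ((hmp.integrableOn_comp_preimage
      (MeasurableEquiv.toLp 2 (Fin n → ℝ)).measurableEmbedding).2
      (hf.integrableOn_isCompact himage)).mono_set (Set.subset_preimage_image _ _)
  have hdiff := IsUnifLocDoublingMeasure.ae_tendsto_average (volume : Measure (Fin n → ℝ)) hcomp 1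
  filter_upwards [(PiLp.volume_preserving_ofLp (Fin n)).quasiMeasurePreserving.ae hdiff]
    with x hx b r hr hr0 hmem
  have hlim := hx (l := atTop) (fun k i => b k i + r k / 2) (fun k => r k / 2)
    (tendsto_nhdsWithin_iff.2 ⟨by simpa using hr0.div_const 2, .of_forall fun k => half_pos (hr k)⟩)
    (.of_forall fun k => by
      simpa [axisCube_eq_preimage_closedBall _ (hr k).le] using hmem k)
  refine hlim.congr fun k => ?_
  rw [axisCube_eq_preimage_closedBall _ (hr k).le, setAverage_preimage_ofLp]

/-- The index of the dyadic cube of generation `k` that contains `x`, in the grid obtained by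
bisecting the cube with lowest corner `a` and side length `s` and its translates. -/
noncomputable def dyadicIndex (a : EuclideanSpace ℝ (Fin n)) (s : ℝ) (k : ℕ)
    (x : EuclideanSpace ℝ (Fin n)) : Fin n → ℤ :=
  fun i => ⌊(x i - a i) / (s / 2 ^ k)⌋

/-- The lowest corner of the dyadic cube of generation `k` that contains `x`. -/
noncomputable def dyadicCorner (a : EuclideanSpace ℝ (Fin n)) (s : ℝ) (k : ℕ)
    (x : EuclideanSpace ℝ (Fin n)) : EuclideanSpace ℝ (Fin n) :=
  WithLp.toLp 2 fun i => a i + dyadicIndex a s k x i * (s / 2 ^ k)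

theorem cell_dyadicIndex (hs : 0 < s) (k : ℕ) (x : EuclideanSpace ℝ (Fin n)) :
    cell (dyadicIndex a s) k x = halfOpenCube (dyadicCorner a s k x) (s / 2 ^ k) := by
  ext y
  have hr : 0 < s / 2 ^ k := by positivity
  change dyadicIndex a s k y = dyadicIndex a s k x ↔ ∀ i, _ ∧ _
  rw [funext_iff]
  refine forall_congr' fun i => ?_
  rw [dyadicIndex, Int.floor_eq_iff, le_div_iff₀ hr, div_lt_iff₀ hr]
  simp only [dyadicCorner]
  constructor <;> rintro ⟨h1, h2⟩ <;> constructor <;> linarith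

theorem cell_dyadicIndex_zero (hs : 0 < s) :
    cell (dyadicIndex a s) 0 a = halfOpenCube a s := by
  rw [cell_dyadicIndex hs]
  congr 1
  · ext i
    simp [dyadicCorner, dyadicIndex]
  · simp

theorem dyadicIndex_eq_ediv_two (k : ℕ) (x : EuclideanSpace ℝ (Fin n)) (i : Fin n) :
    dyadicIndex a s k x i = dyadicIndex a s (k + 1) x i / 2 := by
  have hfloor := Int.floor_div_natCast ((x i - a i) / (s / 2 ^ (k + 1))) 2
  rw [Nat.cast_ofNat, Nat.cast_ofNat] at hfloor
  rw [dyadicIndex, dyadicIndex, ← hfloor, pow_succ]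
  congr 1
  field_simp

theorem isNestedPartition_dyadicIndex (a : EuclideanSpace ℝ (Fin n)) (s : ℝ) :
    IsNestedPartition (dyadicIndex a s) where
  measurableSet_preimage k j := by
    have hmeas : Measurable (dyadicIndex a s k) := by
      unfold dyadicIndex
      fun_prop
    exact hmeas (measurableSet_singleton j)
  refines h := by
    funext i
    rw [dyadicIndex_eq_ediv_two, h, ← dyadicIndex_eq_ediv_two]

theorem volume_cell_dyadicIndex (hs : 0 < s) (k : ℕ) (x : EuclideanSpace ℝ (Fin n)) :
    volume (cell (dyadicIndex a s) k x) = ENNReal.ofReal (s / 2 ^ k) ^ n := by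
  rw [cell_dyadicIndex hs, measure_congr (halfOpenCube_ae_eq_axisCube _ _), volume_axisCube]

theorem volume_cell_dyadicIndex_le (hs : 0 < s) (k : ℕ) (x : EuclideanSpace ℝ (Fin n)) :
    volume (cell (dyadicIndex a s) k x) ≤
      ENNReal.ofReal (2 ^ n) * volume (cell (dyadicIndex a s) (k + 1) x) := by
  rw [volume_cell_dyadicIndex hs, volume_cell_dyadicIndex hs, ENNReal.ofReal_pow zero_le_two,
    ← mul_pow, ← ENNReal.ofReal_mul zero_le_two, pow_succ]
  gcongr
  field_simp
  exact le_rfl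

theorem setAverage_cell_dyadicIndex (hs : 0 < s) (f : EuclideanSpace ℝ (Fin n) → ℝ) (k : ℕ)
    (x : EuclideanSpace ℝ (Fin n)) :
    ⨍ y in cell (dyadicIndex a s) k x, f y =
      ⨍ y in axisCube (dyadicCorner a s k x) (s / 2 ^ k), f y := by
  rw [cell_dyadicIndex hs, setAverage_congr (halfOpenCube_ae_eq_axisCube _ _)]

theorem ae_tendsto_setAverage_cell_dyadicIndex (hs : 0 < s) {f : EuclideanSpace ℝ (Fin n) → ℝ}
    (hf : LocallyIntegrable f volume) :
    ∀ᵐ x, Tendsto (fun k => ⨍ y in cell (dyadicIndex a s) k x, f y) atTop (𝓝 (f x)) := by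
  have hside : Tendsto (fun k : ℕ => s / 2 ^ k) atTop (𝓝 0) :=
    tendsto_const_nhds.div_atTop (tendsto_pow_atTop_atTop_of_one_lt one_lt_two)
  filter_upwards [ae_tendsto_setAverage_axisCube hf] with x hx
  simp only [setAverage_cell_dyadicIndex hs]
  refine hx _ _ (fun k => by positivity) hside fun k => ?_
  rw [← closure_halfOpenCube _ (by positivity), ← cell_dyadicIndex hs]
  exact subset_closure mem_cell_self

end Cubes

/-! ### Interpolation between weak Lebesgue spaces and bounded mean oscillation -/

section Interpolation

variable {n : ℕ} {a : EuclideanSpace ℝ (Fin n)} {s : ℝ} {f : EuclideanSpace ℝ (Fin n) → ℝ}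
  {q p : ℝ}

/-- The mean oscillation `⨍_Q |f - f_Q|` of `f` over the cube with lowest corner `a` and side
length `s`. -/
noncomputable def meanOscillation (f : EuclideanSpace ℝ (Fin n) → ℝ)
    (a : EuclideanSpace ℝ (Fin n)) (s : ℝ) : ℝ≥0∞ :=
  ⨍⁻ x in axisCube a s, ‖f x - ⨍ y in axisCube a s, f y‖ₑ ∂volume

theorem meanOscillation_le_bmoSeminorm (f : EuclideanSpace ℝ (Fin n) → ℝ)
    (a : EuclideanSpace ℝ (Fin n)) (hs : 0 < s) : meanOscillation f a s ≤ bmoSeminorm f :=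
  le_iSup₂_of_le a s (le_iSup (fun _ : 0 < s => meanOscillation f a s) hs)

theorem meanOscillation_le_iff (hs : 0 < s) {b : ℝ≥0∞} :
    meanOscillation f a s ≤ b ↔
      ∫⁻ x in axisCube a s, ‖f x - ⨍ y in axisCube a s, f y‖ₑ ≤ b * volume (axisCube a s) := by
  rw [meanOscillation, setLAverage_eq,
    ENNReal.div_le_iff (volume_axisCube_ne_zero a hs) (volume_axisCube_ne_top a s)]

/-- The constant in the interpolation inequality between `L^{q,∞}` and bounded mean oscillation.
The dimension enters through the doubling constant `2 ^ n` of the dyadic grid. -/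
noncomputable def weakBMOConst (n : ℕ) (q p : ℝ) : ℝ :=
  expDecayConst q p (johnNirenbergRate (2 ^ n))

theorem weakBMOConst_nonneg (n : ℕ) (hp : 0 < p) (hqp : q < p) : 0 ≤ weakBMOConst n q p :=
  expDecayConst_nonneg hp hqp (johnNirenbergRate_pos (by positivity))

theorem meanOscillationLE_dyadicIndex (hs : 0 < s) {B : ℝ}
    (hosc : ∀ b r, 0 < r → axisCube b r ⊆ axisCube a s →
      meanOscillation f b r ≤ ENNReal.ofReal B) :
    MeanOscillationLE (dyadicIndex a s) volume f (halfOpenCube a s) B := by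
  intro k x hsub
  have hr : 0 < s / 2 ^ k := by positivity
  rw [cell_dyadicIndex hs] at hsub
  have hclosed : axisCube (dyadicCorner a s k x) (s / 2 ^ k) ⊆ axisCube a s := by
    simpa only [closure_halfOpenCube, hs, hr] using closure_mono hsub
  rw [setAverage_cell_dyadicIndex hs, cell_dyadicIndex hs,
    setLIntegral_congr (halfOpenCube_ae_eq_axisCube _ _),
    measure_congr (halfOpenCube_ae_eq_axisCube _ _)]
  exact (meanOscillation_le_iff hr).1 (hosc _ _ hr hclosed)

theorem distribFun_axisCube_le_exp_mul (hs : 0 < s) (hf : LocallyIntegrable f volume) {B : ℝ}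
    (hB : 0 < B)
    (hosc : ∀ b r, 0 < r → axisCube b r ⊆ axisCube a s → meanOscillation f b r ≤ ENNReal.ofReal B)
    (havg : |⨍ x in axisCube a s, f x| ≤ 4 * B) {α : ℝ} (hα : 4 ≤ α) :
    distribFun f (volume.restrict (axisCube a s)) (B * α) ≤
      ENNReal.ofReal (4 * Real.exp (-(johnNirenbergRate (2 ^ n) * (α - 4)))) *
        distribFun f (volume.restrict (axisCube a s)) (2 * B) := by
  have hroot : cell (dyadicIndex a s) 0 a = halfOpenCube a s := cell_dyadicIndex_zero hs
  have hcube := halfOpenCube_ae_eq_axisCube a s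
  rw [← Measure.restrict_congr_set hcube, ← hroot]
  refine distribFun_le_exp_mul_distribFun (isNestedPartition_dyadicIndex a s) ?_ ?_
    (by positivity) hB ?_ (volume_cell_dyadicIndex_le hs) ?_
    (ae_tendsto_setAverage_cell_dyadicIndex hs hf) hα
  · rw [hroot, measure_congr hcube]
    exact volume_axisCube_ne_top a s
  · rw [hroot, integrableOn_congr_set_ae hcube]
    exact hf.integrableOn_isCompact (isCompact_axisCube a s)
  · rw [hroot]
    exact meanOscillationLE_dyadicIndex hs hosc
  · rwa [hroot, setAverage_congr hcube]

theorem lintegral_axisCube_enorm_rpow_le (hs : 0 < s) (hf : LocallyIntegrable f volume)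
    (hw : weakLpNorm f q (volume.restrict (axisCube a s)) ≠ ⊤) (hq : 0 < q) (hqp : q < p) {B : ℝ}
    (hB : 0 < B)
    (hosc : ∀ b r, 0 < r → axisCube b r ⊆ axisCube a s → meanOscillation f b r ≤ ENNReal.ofReal B)
    (havg : |⨍ x in axisCube a s, f x| ≤ 4 * B) :
    ∫⁻ x in axisCube a s, ‖f x‖ₑ ^ p ≤ weakLpNorm f q (volume.restrict (axisCube a s)) ^ q *
      ENNReal.ofReal (weakBMOConst n q p * B ^ (p - q)) :=
  lintegral_enorm_rpow_le_weakLpNorm_rpow_mul hf.aestronglyMeasurable.aemeasurable.restrict hw hq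
    hqp hB (johnNirenbergRate_pos (by positivity))
    fun _ hα => distribFun_axisCube_le_exp_mul hs hf hB hosc havg hα

theorem memLp_and_eLpNorm_axisCube_le_weakLpNorm_mul (hs : 0 < s) (hf : LocallyIntegrable f volume)
    (hw : weakLpNorm f q (volume.restrict (axisCube a s)) ≠ ⊤) (hq : 0 < q) (hqp : q < p)
    {b : ℝ≥0∞} (hb : b ≠ ⊤)
    (hosc : ∀ a' r, 0 < r → axisCube a' r ⊆ axisCube a s → meanOscillation f a' r ≤ b)
    (havg : ∫ x in axisCube a s, f x = 0) :
    MemLp f (ENNReal.ofReal p) (volume.restrict (axisCube a s)) ∧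
      eLpNorm f (ENNReal.ofReal p) (volume.restrict (axisCube a s)) ≤
        ENNReal.ofReal (weakBMOConst n q p ^ (1 / p)) *
          weakLpNorm f q (volume.restrict (axisCube a s)) ^ (q / p) * b ^ (1 - q / p) := by
  refine memLp_and_eLpNorm_le_of_forall_lintegral_enorm_rpow_le hf.aestronglyMeasurable.restrict
    hq hqp hw hb (weakBMOConst_nonneg n (hq.trans hqp) hqp) fun B hB hbB => ?_
  refine lintegral_axisCube_enorm_rpow_le hs hf hw hq hqp hB
    (fun a' r hr hsub => (hosc a' r hr hsub).trans hbB) ?_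
  rw [setAverage_eq, havg, smul_zero, abs_zero]
  positivity

theorem abs_setAverage_axisCube_le (hs : 0 < s) (hf : LocallyIntegrable f volume) {B : ℝ}
    (hB : 0 < B) (hosc : meanOscillation f a s ≤ ENNReal.ofReal B)
    (hlarge : 2 * distribFun f volume (2 * B) < volume (axisCube a s)) :
    |⨍ x in axisCube a s, f x| ≤ 4 * B := by
  have : IsFiniteMeasure (volume.restrict (axisCube a s)) :=
    isFiniteMeasure_restrict.2 (volume_axisCube_ne_top a s)
  refine abs_average_le_of_two_mul_distribFun_lt hf.aestronglyMeasurable.restrict hB ?_ ?_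
  · rw [Measure.restrict_apply_univ]
    exact (meanOscillation_le_iff hs).1 hosc
  · rw [Measure.restrict_apply_univ]
    refine lt_of_le_of_lt ?_ hlarge
    gcongr
    exact Measure.restrict_apply_le _ _

theorem mem_axisCube_neg_two_mul_iff {N : ℝ} {x : EuclideanSpace ℝ (Fin n)} :
    x ∈ axisCube (WithLp.toLp 2 fun _ => -N) (2 * N) ↔ ∀ i, |x i| ≤ N := by
  simp only [axisCube, Set.mem_ofPred_eq, Set.mem_Icc, abs_le,
    show -N + 2 * N = N by ring]

theorem tendsto_setLIntegral_axisCube (u : EuclideanSpace ℝ (Fin n) → ℝ≥0∞) :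
    Tendsto (fun N : ℕ => ∫⁻ x in axisCube (WithLp.toLp 2 fun _ => -(N : ℝ)) (2 * N), u x)
      atTop (𝓝 (∫⁻ x, u x)) := by
  have hmono : Monotone fun N : ℕ =>
      axisCube (n := n) (WithLp.toLp 2 fun _ => -(N : ℝ)) (2 * N) := by
    intro N M hNM x hx
    rw [mem_axisCube_neg_two_mul_iff] at hx ⊢
    exact fun i => (hx i).trans (Nat.cast_le.2 hNM)
  have hunion : ⋃ N : ℕ, axisCube (n := n) (WithLp.toLp 2 fun _ => -(N : ℝ)) (2 * N) =
      Set.univ := by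
    refine Set.eq_univ_of_forall fun x => Set.mem_iUnion.2 ⟨⌈‖x‖⌉₊, ?_⟩
    exact mem_axisCube_neg_two_mul_iff.2 fun i => (PiLp.norm_apply_le x i).trans (Nat.le_ceil _)
  rw [← setLIntegral_univ u, ← hunion, setLIntegral_iUnion_of_directed _ hmono.directed_le]
  exact tendsto_atTop_iSup fun N M hNM => lintegral_mono_set (hmono hNM)

theorem tendsto_volume_axisCube_top (hn : 1 ≤ n) :
    Tendsto (fun N : ℕ => volume (axisCube (n := n) (WithLp.toLp 2 fun _ => -(N : ℝ)) (2 * N)))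
      atTop (𝓝 ⊤) := by
  have : Nonempty (Fin n) := ⟨⟨0, hn⟩⟩
  have hlim := tendsto_setLIntegral_axisCube fun _ : EuclideanSpace ℝ (Fin n) => 1
  simpa only [lintegral_one, Measure.restrict_apply_univ,
    measure_univ_of_isAddLeftInvariant] using hlim

/-- On a large cube the weak bound makes `|f|` small on half of the cube, so that the average of
`f` is controlled by the oscillation and the estimate on cubes applies. -/
theorem lintegral_enorm_rpow_le_of_bmoSeminorm_le (hn : 1 ≤ n) (hf : LocallyIntegrable f volume)
    (hw : weakLpNorm f q volume ≠ ⊤) (hq : 0 < q) (hqp : q < p) {B : ℝ} (hB : 0 < B)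
    (hosc : bmoSeminorm f ≤ ENNReal.ofReal B) :
    ∫⁻ x, ‖f x‖ₑ ^ p ≤
      weakLpNorm f q volume ^ q * ENNReal.ofReal (weakBMOConst n q p * B ^ (p - q)) := by
  have hosc' : ∀ a s, 0 < s → meanOscillation f a s ≤ ENNReal.ofReal B := fun a s hs =>
    (meanOscillation_le_bmoSeminorm f a hs).trans hosc
  have hdistrib : 2 * distribFun f volume (2 * B) < ⊤ :=
    ENNReal.mul_lt_top ENNReal.ofNat_lt_top <|
      (distribFun_le_weakLpNorm_rpow_mul hq (by positivity)).trans_lt <|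
        ENNReal.mul_lt_top (ENNReal.rpow_lt_top_of_nonneg hq.le hw) ENNReal.ofReal_lt_top
  refine le_of_tendsto (tendsto_setLIntegral_axisCube _) ?_
  filter_upwards [(tendsto_volume_axisCube_top hn).eventually (lt_mem_nhds hdistrib),
    eventually_gt_atTop 0] with N hlarge hN
  have hs : (0 : ℝ) < 2 * N := by positivity
  have hmono : weakLpNorm f q (volume.restrict (axisCube (WithLp.toLp 2 fun _ => -(N : ℝ))
      (2 * N))) ≤ weakLpNorm f q volume := weakLpNorm_mono_measure Measure.restrict_le_self
  refine (lintegral_axisCube_enorm_rpow_le hs hf (ne_top_of_le_ne_top hw hmono) hq hqp hB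
    (fun b r hr _ => hosc' b r hr)
    (abs_setAverage_axisCube_le hs hf hB (hosc' _ _ hs) hlarge)).trans ?_
  gcongr

theorem memLp_and_eLpNorm_le_weakLpNorm_mul_bmoSeminorm (hn : 1 ≤ n) (hq : 0 < q) (hqp : q < p)
    (hf : MemWeakLp f q volume) (hbmo : MemBMO f) :
    MemLp f (ENNReal.ofReal p) volume ∧
      eLpNorm f (ENNReal.ofReal p) volume ≤ ENNReal.ofReal (weakBMOConst n q p ^ (1 / p)) *
        weakLpNorm f q volume ^ (q / p) * bmoSeminorm f ^ (1 - q / p) :=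
  memLp_and_eLpNorm_le_of_forall_lintegral_enorm_rpow_le hf.1 hq hqp hf.2.ne hbmo.2.ne
    (weakBMOConst_nonneg n (hq.trans hqp) hqp) fun _ hB hbB =>
      lintegral_enorm_rpow_le_of_bmoSeminorm_le hn hbmo.1 hf.2.ne hq hqp hB hbB

end Interpolation

/-! ### Integration along translates -/

section Translates

variable {E F : Type*} [NormedAddCommGroup E] [NormedAddCommGroup F]

theorem locallyIntegrable_comp_add_right [MeasurableSpace E] [BorelSpace E] {μ : Measure E}
    [μ.IsAddRightInvariant] {f : E → F} (hf : LocallyIntegrable f μ) (v : E) :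
    LocallyIntegrable (fun x => f (x + v)) μ := by
  rw [← map_add_right_eq_self μ v] at hf
  exact (locallyIntegrable_map_homeomorph (Homeomorph.addRight v)).1 hf

variable [NormedSpace ℝ E]

theorem integral_fderiv_sub_smul {φ : E → ℝ} (hφ : ContDiff ℝ 1 φ) (x v : E) :
    ∫ t in Set.Icc (0 : ℝ) 1, fderiv ℝ φ (x - t • v) v = φ x - φ (x - v) := by
  have hderiv (t : ℝ) :
      HasDerivAt (fun t : ℝ => -φ (x - t • v)) (fderiv ℝ φ (x - t • v) v) t := by
    have hline : HasDerivAt (fun t : ℝ => x - t • v) (-v) t := by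
      simpa using ((hasDerivAt_id t).smul_const v).const_sub x
    simpa [Function.comp_def, Pi.neg_def] using
      ((hφ.differentiable one_ne_zero (x - t • v)).hasFDerivAt.comp_hasDerivAt t hline).neg
  have hcont : Continuous fun t : ℝ => fderiv ℝ φ (x - t • v) v :=
    ((hφ.continuous_fderiv one_ne_zero).clm_apply continuous_const).comp
      (g := fun y => fderiv ℝ φ y v) (by fun_prop : Continuous fun t : ℝ => x - t • v)
  rw [integral_Icc_eq_integral_Ioc, ← intervalIntegral.integral_of_le zero_le_one,
    intervalIntegral.integral_eq_sub_of_hasDerivAt (fun t _ => hderiv t)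
      (hcont.intervalIntegrable _ _)]
  simp only [one_smul, zero_smul, sub_zero]
  ring

variable [MeasurableSpace E] [BorelSpace E] [SecondCountableTopology E] {μ : Measure E}
  [μ.IsAddRightInvariant] [SFinite μ]

theorem measurePreserving_shear (τ : Measure ℝ) [SFinite τ] (v : E) :
    MeasurePreserving (fun z : ℝ × E => (z.1, z.2 + z.1 • v)) (τ.prod μ) (τ.prod μ) :=
  (MeasurePreserving.id τ).skew_product (g := fun t x => x + t • v) (by fun_prop)
    (Eventually.of_forall fun t => (measurePreserving_add_right μ (t • v)).map_eq)

theorem integrable_comp_add_smul_of_isCompact {u : E → F} (hu : LocallyIntegrable u μ) {K : Set E}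
    (hK : IsCompact K) (v : E) :
    Integrable (fun z : ℝ × E => u (z.2 + z.1 • v))
      ((volume.restrict (Set.Icc (0 : ℝ) 1)).prod (μ.restrict K)) := by
  set K' : Set E := (fun z : ℝ × E => z.2 + z.1 • v) '' (Set.Icc (0 : ℝ) 1 ×ˢ K)
  have hK' : IsCompact K' := (isCompact_Icc.prod hK).image (by fun_prop)
  have hsnd : Integrable (fun z : ℝ × E => K'.indicator u z.2)
      ((volume.restrict (Set.Icc (0 : ℝ) 1)).prod μ) :=
    ((integrable_indicator_iff hK'.measurableSet).2 (hu.integrableOn_isCompact hK')).comp_snd _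
  have hshear := (measurePreserving_shear _ v).integrable_comp_of_integrable hsnd
  rw [Measure.prod_restrict]
  refine (hshear.mono_measure ?_).congr ?_
  · rw [← Measure.restrict_univ (μ := μ), Measure.prod_restrict, Measure.restrict_univ]
    exact Measure.restrict_mono (Set.prod_mono_right (Set.subset_univ K)) le_rfl
  · exact (ae_restrict_mem (measurableSet_Icc.prod hK.measurableSet)).mono fun z hz =>
      Set.indicator_of_mem (Set.mem_image_of_mem _ hz) _

theorem locallyIntegrable_integral_add_smul [LocallyCompactSpace E] [NormedSpace ℝ F] {u : E → F}
    (hu : LocallyIntegrable u μ) (v : E) :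
    LocallyIntegrable (fun x => ∫ t in Set.Icc (0 : ℝ) 1, u (x + t • v)) μ :=
  locallyIntegrable_iff.2 fun _ hK =>
    (integrable_comp_add_smul_of_isCompact hu hK v).integral_prod_right

theorem integrable_mul_comp_add_smul {u ψ : E → ℝ} (hu : LocallyIntegrable u μ)
    (hψ : Continuous ψ) (hs : HasCompactSupport ψ) (v : E) :
    Integrable (fun z : ℝ × E => ψ z.2 * u (z.2 + z.1 • v))
      ((volume.restrict (Set.Icc (0 : ℝ) 1)).prod μ) := by
  obtain ⟨C, hC⟩ := hs.exists_bound_of_continuous hψ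
  have hint := (integrable_comp_add_smul_of_isCompact hu hs.isCompact v).bdd_mul
    (f := fun z => ψ z.2) (hψ.comp continuous_snd).aestronglyMeasurable
    (Eventually.of_forall fun z => hC z.2)
  rw [← Measure.restrict_univ (μ := volume.restrict (Set.Icc (0 : ℝ) 1)),
    Measure.prod_restrict] at hint
  refine (integrableOn_iff_integrable_of_support_subset fun z hz => ?_).1 hint
  exact ⟨Set.mem_univ _, subset_tsupport ψ (left_ne_zero_of_mul hz)⟩

theorem integrable_mul_comp_sub_smul {u ψ : E → ℝ} (hu : LocallyIntegrable u μ)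
    (hψ : Continuous ψ) (hs : HasCompactSupport ψ) (v : E) :
    Integrable (fun z : ℝ × E => u z.2 * ψ (z.2 - z.1 • v))
      ((volume.restrict (Set.Icc (0 : ℝ) 1)).prod μ) := by
  refine ((measurePreserving_shear _ (-v)).integrable_comp_of_integrable
    (integrable_mul_comp_add_smul hu hψ hs v)).congr (Eventually.of_forall fun z => ?_)
  simp [mul_comm, sub_eq_add_neg]

end Translates

theorem setLIntegral_setLIntegral_eq_lintegral_translate {G : Type*} [AddGroup G]
    [MeasurableSpace G] [MeasurableAdd₂ G] {μ : Measure G} [SFinite μ] [μ.IsAddLeftInvariant]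
    {s t : Set G} (hs : MeasurableSet s) (ht : MeasurableSet t) {F : G → G → ℝ≥0∞}
    (hF : Measurable (Function.uncurry F)) :
    ∫⁻ x in s, ∫⁻ y in t, F x y ∂μ ∂μ =
      ∫⁻ v, ∫⁻ x in s ∩ (fun x => x + v) ⁻¹' t, F x (x + v) ∂μ ∂μ := by
  have hadd : Measurable fun z : G × G => (z.1, z.1 + z.2) := by fun_prop
  set T : Set (G × G) := (fun z => (z.1, z.1 + z.2)) ⁻¹' (s ×ˢ t)
  have hT : MeasurableSet T := hadd (hs.prod ht)
  set H : G → G → ℝ≥0∞ := fun x v => T.indicator (fun z => F z.1 (z.1 + z.2)) (x, v)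
  have hH : Measurable (Function.uncurry H) := (hF.comp hadd).indicator hT
  calc ∫⁻ x in s, ∫⁻ y in t, F x y ∂μ ∂μ = ∫⁻ x, ∫⁻ v, H x v ∂μ ∂μ := by
        rw [← lintegral_indicator hs]
        refine lintegral_congr fun x => ?_
        by_cases hx : x ∈ s
        · rw [Set.indicator_of_mem hx, ← lintegral_indicator ht, ← lintegral_add_left_eq_self _ x]
          refine lintegral_congr fun v => ?_
          by_cases hv : x + v ∈ t <;> simp [H, T, hx, hv]
        · simp [H, T, hx]
    _ = ∫⁻ v, ∫⁻ x, H x v ∂μ ∂μ := lintegral_lintegral_swap hH.aemeasurable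
    _ = ∫⁻ v, ∫⁻ x in s ∩ (fun x => x + v) ⁻¹' t, F x (x + v) ∂μ ∂μ := by
        refine lintegral_congr fun v => ?_
        rw [← lintegral_indicator (hs.inter (measurable_add_const v ht))]
        rfl

theorem measure_univ_mul_lintegral_sub_average_le {X : Type*} [MeasurableSpace X] {μ : Measure X}
    [IsFiniteMeasure μ] {f : X → ℝ} (hf : Integrable f μ) :
    μ Set.univ * ∫⁻ x, ‖f x - ⨍ y, f y ∂μ‖ₑ ∂μ ≤ ∫⁻ x, ∫⁻ y, ‖f x - f y‖ₑ ∂μ ∂μ := by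
  rw [← lintegral_const_mul' _ _ (measure_ne_top _ _)]
  refine lintegral_mono fun x => ?_
  rw [mul_comm, enorm_sub_rev]
  simpa only [enorm_sub_rev (f x)] using enorm_average_sub_mul_measure_univ_le hf (f x)

/-! ### Weak gradients and the Poincaré inequality on cubes -/

section WeakGradient

variable {n : ℕ} {f : EuclideanSpace ℝ (Fin n) → ℝ}
  {g : EuclideanSpace ℝ (Fin n) → EuclideanSpace ℝ (Fin n)}

theorem gradient_apply (φ : EuclideanSpace ℝ (Fin n) → ℝ) (x : EuclideanSpace ℝ (Fin n))
    (i : Fin n) : (gradient φ x) i = fderiv ℝ φ x (EuclideanSpace.single i 1) := by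
  rw [← inner_gradient_left, EuclideanSpace.inner_single_right]
  simp

theorem continuous_gradient_apply {φ : EuclideanSpace ℝ (Fin n) → ℝ} (hφ : ContDiff ℝ ∞ φ)
    (i : Fin n) : Continuous fun x => (gradient φ x) i := by
  simpa only [gradient_apply] using
    (hφ.continuous_fderiv (by simp)).clm_apply continuous_const

theorem hasCompactSupport_gradient_apply {φ : EuclideanSpace ℝ (Fin n) → ℝ}
    (hs : HasCompactSupport φ) (i : Fin n) : HasCompactSupport fun x => (gradient φ x) i := by
  simpa only [gradient_apply] using hs.fderiv_apply ℝ _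

theorem IsWeakGradient.locallyIntegrable (h : IsWeakGradient Set.univ f g) :
    LocallyIntegrable f volume :=
  locallyIntegrableOn_univ.1 h.1

theorem IsWeakGradient.locallyIntegrable_gradient (h : IsWeakGradient Set.univ f g) :
    LocallyIntegrable g volume :=
  locallyIntegrableOn_univ.1 h.2.1

theorem IsWeakGradient.locallyIntegrable_inner (h : IsWeakGradient Set.univ f g)
    (v : EuclideanSpace ℝ (Fin n)) : LocallyIntegrable (fun x => inner ℝ (g x) v) volume :=
  fun x => by
    obtain ⟨s, hs, hint⟩ := h.locallyIntegrable_gradient x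
    exact ⟨s, hs, hint.inner_const v⟩

theorem IsWeakGradient.congr_ae (h : IsWeakGradient Set.univ f g)
    {f' : EuclideanSpace ℝ (Fin n) → ℝ}
    {g' : EuclideanSpace ℝ (Fin n) → EuclideanSpace ℝ (Fin n)}
    (hf : f =ᵐ[volume] f') (hg : g =ᵐ[volume] g') : IsWeakGradient Set.univ f' g' := by
  refine ⟨locallyIntegrableOn_univ.2 (h.locallyIntegrable.congr hf),
    locallyIntegrableOn_univ.2 (h.locallyIntegrable_gradient.congr hg), fun φ hφ i => ?_⟩
  have hf_eq : ∫ x in Set.univ, f x * (gradient φ x) i = ∫ x in Set.univ, f' x * (gradient φ x) i :=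
    setIntegral_congr_ae MeasurableSet.univ (hf.mono fun x hx _ => by rw [hx])
  have hg_eq : ∫ x in Set.univ, (g x) i * φ x = ∫ x in Set.univ, (g' x) i * φ x :=
    setIntegral_congr_ae MeasurableSet.univ (hg.mono fun x hx _ => by rw [hx])
  rw [← hf_eq, ← hg_eq, h.2.2 φ hφ i]

theorem IsWeakGradient.integral_mul_fderiv (h : IsWeakGradient Set.univ f g)
    {φ : EuclideanSpace ℝ (Fin n) → ℝ} (hφ : ContDiff ℝ ∞ φ) (hs : HasCompactSupport φ)
    (v : EuclideanSpace ℝ (Fin n)) :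
    ∫ x, f x * fderiv ℝ φ x v = -∫ x, φ x * inner ℝ (g x) v := by
  have hinner (y : EuclideanSpace ℝ (Fin n)) : inner ℝ y v = ∑ i, v i * y i := by
    simp [PiLp.inner_apply]
  have hf_int (i : Fin n) : Integrable (fun x => (gradient φ x) i * f x) volume :=
    h.locallyIntegrable.integrable_smul_left_of_hasCompactSupport
      (continuous_gradient_apply hφ i) (hasCompactSupport_gradient_apply hs i)
  have hg_int (i : Fin n) : Integrable (fun x => φ x * (g x) i) volume := by
    simpa [Function.comp_def] using (EuclideanSpace.proj (𝕜 := ℝ) i).integrable_comp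
      (h.locallyIntegrable_gradient.integrable_smul_left_of_hasCompactSupport hφ.continuous hs)
  have hparts (i : Fin n) : ∫ x, (gradient φ x) i * f x = -∫ x, φ x * (g x) i := by
    simpa only [Measure.restrict_univ, mul_comm] using h.2.2 φ ⟨hφ, hs, Set.subset_univ _⟩ i
  simp only [← inner_gradient_left, hinner, Finset.mul_sum, mul_left_comm _ (v _)]
  rw [integral_finsetSum _ fun i _ => by simpa only [mul_comm] using (hf_int i).const_mul (v i),
    integral_finsetSum _ fun i _ => (hg_int i).const_mul (v i), ← Finset.sum_neg_distrib]
  refine Finset.sum_congr rfl fun i _ => ?_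
  rw [integral_const_mul, integral_const_mul, ← mul_neg, ← hparts i]
  simp only [mul_comm (f _)]

theorem IsWeakGradient.integral_mul_fderiv_sub (h : IsWeakGradient Set.univ f g)
    {φ : EuclideanSpace ℝ (Fin n) → ℝ} (hφ : ContDiff ℝ ∞ φ) (hs : HasCompactSupport φ)
    (v w : EuclideanSpace ℝ (Fin n)) :
    ∫ x, f x * fderiv ℝ φ (x - w) v = -∫ x, φ x * inner ℝ (g (x + w)) v := by
  have htranslate := h.integral_mul_fderiv (φ := fun x => φ (x - w))
    (hφ.comp (contDiff_id.sub contDiff_const)) (hs.comp_homeomorph (Homeomorph.subRight w)) v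
  rw [← integral_add_right_eq_self (fun x => φ (x - w) * inner ℝ (g x) v) w] at htranslate
  simpa only [fderiv_comp_sub, add_sub_cancel_right] using htranslate

theorem IsWeakGradient.integral_mul_sub_eq (h : IsWeakGradient Set.univ f g)
    {φ : EuclideanSpace ℝ (Fin n) → ℝ} (hφ : ContDiff ℝ ∞ φ) (hs : HasCompactSupport φ)
    (v : EuclideanSpace ℝ (Fin n)) :
    ∫ x, φ x * (f (x + v) - f x) =
      ∫ x, φ x * ∫ t in Set.Icc (0 : ℝ) 1, inner ℝ (g (x + t • v)) v := by
  have hf := h.locallyIntegrable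
  have hf_int : Integrable (fun x => φ x * f x) volume :=
    hf.integrable_smul_left_of_hasCompactSupport hφ.continuous hs
  have hfv_int : Integrable (fun x => φ x * f (x + v)) volume :=
    (locallyIntegrable_comp_add_right hf v).integrable_smul_left_of_hasCompactSupport
      hφ.continuous hs
  have hφv : ∫ x, φ x * f (x + v) = ∫ x, φ (x - v) * f x := by
    simpa using (integral_sub_right_eq_self (fun x => φ x * f (x + v)) v).symm
  have hφv_int : Integrable (fun x => φ (x - v) * f x) volume := by
    simpa using hfv_int.comp_sub_right v
  calc ∫ x, φ x * (f (x + v) - f x)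
      = -∫ x, f x * (φ x - φ (x - v)) := by
        simp only [mul_comm (f _) (_ - _), mul_sub, sub_mul]
        rw [integral_sub hfv_int hf_int, integral_sub hf_int hφv_int, hφv, neg_sub]
    _ = -∫ x, ∫ t in Set.Icc (0 : ℝ) 1, f x * fderiv ℝ φ (x - t • v) v := by
        simp only [integral_const_mul, integral_fderiv_sub_smul (hφ.of_le (by simp))]
    _ = -∫ t in Set.Icc (0 : ℝ) 1, ∫ x, f x * fderiv ℝ φ (x - t • v) v := by
        rw [integral_integral_swap]
        exact (integrable_mul_comp_sub_smul hf
          ((hφ.continuous_fderiv (by simp)).clm_apply continuous_const)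
          (hs.fderiv_apply ℝ v) v).swap
    _ = ∫ t in Set.Icc (0 : ℝ) 1, ∫ x, φ x * inner ℝ (g (x + t • v)) v := by
        simp only [h.integral_mul_fderiv_sub hφ hs, integral_neg, neg_neg]
    _ = ∫ x, φ x * ∫ t in Set.Icc (0 : ℝ) 1, inner ℝ (g (x + t • v)) v := by
        rw [integral_integral_swap (integrable_mul_comp_add_smul (h.locallyIntegrable_inner v)
          hφ.continuous hs v)]
        simp only [integral_const_mul]

theorem IsWeakGradient.ae_sub_eq_integral (h : IsWeakGradient Set.univ f g)
    (v : EuclideanSpace ℝ (Fin n)) :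
    ∀ᵐ x, f (x + v) - f x = ∫ t in Set.Icc (0 : ℝ) 1, inner ℝ (g (x + t • v)) v :=
  ae_eq_of_integral_contDiff_smul_eq
    ((locallyIntegrable_comp_add_right h.locallyIntegrable v).sub h.locallyIntegrable)
    (locallyIntegrable_integral_add_smul (h.locallyIntegrable_inner v) v)
    fun _ hφ hs => h.integral_mul_sub_eq hφ hs v

theorem IsWeakGradient.lintegral_sub_translate_le (h : IsWeakGradient Set.univ f g)
    (hg : Measurable g) {Q : Set (EuclideanSpace ℝ (Fin n))} (hQ : Convex ℝ Q)
    (hQm : MeasurableSet Q) (v : EuclideanSpace ℝ (Fin n)) :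
    ∫⁻ x in Q ∩ (fun x => x + v) ⁻¹' Q, ‖f x - f (x + v)‖ₑ ≤ ‖v‖ₑ * ∫⁻ x in Q, ‖g x‖ₑ := by
  set G : EuclideanSpace ℝ (Fin n) → ℝ≥0∞ := Q.indicator fun x => ‖v‖ₑ * ‖g x‖ₑ
  have hG : Measurable G := (by fun_prop : Measurable fun x => ‖v‖ₑ * ‖g x‖ₑ).indicator hQm
  have hinner (x : EuclideanSpace ℝ (Fin n)) (t : ℝ) (hxt : x + t • v ∈ Q) :
      ‖inner ℝ (g (x + t • v)) v‖ₑ ≤ G (x + t • v) := by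
    rw [show G (x + t • v) = ‖v‖ₑ * ‖g (x + t • v)‖ₑ from Set.indicator_of_mem hxt _, mul_comm]
    simpa only [← ofReal_norm, ← ENNReal.ofReal_mul (norm_nonneg _)] using
      ENNReal.ofReal_le_ofReal (norm_inner_le_norm (𝕜 := ℝ) (g (x + t • v)) v)
  have hpointwise : ∀ᵐ x, x ∈ Q ∩ (fun x => x + v) ⁻¹' Q →
      ‖f x - f (x + v)‖ₑ ≤ ∫⁻ t in Set.Icc (0 : ℝ) 1, G (x + t • v) := by
    filter_upwards [h.ae_sub_eq_integral v] with x hx hxQ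
    rw [enorm_sub_rev, hx]
    exact (enorm_integral_le_lintegral_enorm _).trans <|
      setLIntegral_mono' measurableSet_Icc fun t ht => hinner x t <|
        hQ.add_smul_mem hxQ.1 hxQ.2 ht
  calc ∫⁻ x in Q ∩ (fun x => x + v) ⁻¹' Q, ‖f x - f (x + v)‖ₑ
      ≤ ∫⁻ x, ∫⁻ t in Set.Icc (0 : ℝ) 1, G (x + t • v) :=
        (setLIntegral_mono_ae' (hQm.inter (measurable_add_const v hQm)) hpointwise).trans
          (setLIntegral_le_lintegral _ _)
    _ = ∫⁻ t in Set.Icc (0 : ℝ) 1, ∫⁻ x, G (x + t • v) :=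
        lintegral_lintegral_swap (hG.comp (by fun_prop)).aemeasurable
    _ = ∫⁻ t in Set.Icc (0 : ℝ) 1, ∫⁻ x, G x := by simp_rw [lintegral_add_right_eq_self]
    _ = ‖v‖ₑ * ∫⁻ x in Q, ‖g x‖ₑ := by
        simp [G, lintegral_indicator hQm, lintegral_const_mul _ hg.enorm]

open scoped Pointwise in
theorem IsWeakGradient.lintegral_lintegral_sub_le (h : IsWeakGradient Set.univ f g)
    (hf : Measurable f) (hg : Measurable g) {Q : Set (EuclideanSpace ℝ (Fin n))}
    (hQ : Convex ℝ Q) (hQm : MeasurableSet Q) :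
    ∫⁻ x in Q, ∫⁻ y in Q, ‖f x - f y‖ₑ ≤
      (Metric.ediam Q * ∫⁻ x in Q, ‖g x‖ₑ) * volume (Q - Q) := by
  rw [setLIntegral_setLIntegral_eq_lintegral_translate hQm hQm (by fun_prop)]
  refine (lintegral_mono fun v => ?_).trans (lintegral_indicator_const_le (Q - Q) _)
  by_cases hv : v ∈ Q - Q
  · rw [Set.indicator_of_mem hv]
    obtain ⟨y, hy, x, hx, rfl⟩ := hv
    grw [h.lintegral_sub_translate_le hg hQ hQm (y - x), ← edist_eq_enorm_sub,
      Metric.edist_le_ediam_of_mem hy hx]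
  · have hempty : Q ∩ (fun x => x + v) ⁻¹' Q = ∅ :=
      Set.eq_empty_of_forall_notMem fun x hx =>
        hv ⟨x + v, hx.2, x, hx.1, add_sub_cancel_left x v⟩
    simp [hempty]

theorem convex_axisCube (a : EuclideanSpace ℝ (Fin n)) (s : ℝ) : Convex ℝ (axisCube a s) := by
  intro x hx y hy t u ht hu htu i
  simpa using convex_Icc (a i) (a i + s) (hx i) (hy i) ht hu htu

open scoped Pointwise in
theorem axisCube_sub_axisCube_subset (a : EuclideanSpace ℝ (Fin n)) (s : ℝ) :
    axisCube a s - axisCube a s ⊆ axisCube (WithLp.toLp 2 fun _ => -s) (2 * s) := by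
  rintro _ ⟨x, hx, y, hy, rfl⟩ i
  have hxi := hx i
  have hyi := hy i
  simp only [Set.mem_Icc, PiLp.sub_apply] at hxi hyi ⊢
  constructor <;> linarith

theorem ediam_axisCube_le (a : EuclideanSpace ℝ (Fin n)) (s : ℝ) :
    Metric.ediam (axisCube a s) ≤ n * ENNReal.ofReal s := by
  refine Metric.ediam_le fun x hx y hy => ?_
  have hcoord (i : Fin n) : ‖(x - y) i‖ ≤ s := by
    have hxi := hx i
    have hyi := hy i
    simp only [Set.mem_Icc, PiLp.sub_apply, Real.norm_eq_abs, abs_le] at hxi hyi ⊢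
    constructor <;> linarith
  have hnorm : ‖x - y‖ ≤ n * s := by
    have hsum : ‖∑ i, (x - y) i • EuclideanSpace.basisFun (Fin n) ℝ i‖ ≤ ∑ _ : Fin n, s :=
      norm_sum_le_of_le _ fun i _ => by simpa [norm_smul] using hcoord i
    have hrepr := (EuclideanSpace.basisFun (Fin n) ℝ).sum_repr (x - y)
    simp only [EuclideanSpace.basisFun_repr] at hrepr
    rwa [hrepr, Finset.sum_const, Finset.card_univ, Fintype.card_fin, nsmul_eq_mul] at hsum
  rw [edist_eq_enorm_sub, ← ofReal_norm]
  exact (ENNReal.ofReal_le_ofReal hnorm).trans_eq (by simp [ENNReal.ofReal_mul])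

open scoped Pointwise in
theorem IsWeakGradient.lintegral_sub_average_axisCube_le (h : IsWeakGradient Set.univ f g)
    (a : EuclideanSpace ℝ (Fin n)) {s : ℝ} (hs : 0 < s) :
    ∫⁻ x in axisCube a s, ‖f x - ⨍ y in axisCube a s, f y‖ₑ ≤
      n * 2 ^ n * ENNReal.ofReal s * ∫⁻ x in axisCube a s, ‖g x‖ₑ := by
  wlog hm : Measurable f ∧ Measurable g generalizing f g
  · have hf := h.locallyIntegrable.aestronglyMeasurable
    have hg := h.locallyIntegrable_gradient.aestronglyMeasurable
    have hmk := this (h.congr_ae hf.ae_eq_mk hg.ae_eq_mk)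
      ⟨hf.stronglyMeasurable_mk.measurable, hg.stronglyMeasurable_mk.measurable⟩
    rw [← average_congr (ae_restrict_of_ae hf.ae_eq_mk)] at hmk
    have hg_eq : ∫⁻ x in axisCube a s, ‖g x‖ₑ = ∫⁻ x in axisCube a s, ‖hg.mk g x‖ₑ :=
      lintegral_congr_ae (ae_restrict_of_ae (hg.ae_eq_mk.fun_comp enorm))
    rwa [hg_eq,
      lintegral_congr_ae (ae_restrict_of_ae (hf.ae_eq_mk.mono fun x hx => by rw [hx]))]
  have hint : IntegrableOn f (axisCube a s) volume :=
    h.locallyIntegrable.integrableOn_isCompact (isCompact_axisCube a s)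
  have : IsFiniteMeasure (volume.restrict (axisCube a s)) :=
    isFiniteMeasure_restrict.2 (volume_axisCube_ne_top a s)
  have hdiff : volume (axisCube a s - axisCube a s) ≤ 2 ^ n * volume (axisCube a s) := by
    grw [axisCube_sub_axisCube_subset, volume_axisCube, volume_axisCube,
      ENNReal.ofReal_mul zero_le_two, mul_pow, ENNReal.ofReal_ofNat]
  have hmul := calc
    volume (axisCube a s) * ∫⁻ x in axisCube a s, ‖f x - ⨍ y in axisCube a s, f y‖ₑ
      ≤ ∫⁻ x in axisCube a s, ∫⁻ y in axisCube a s, ‖f x - f y‖ₑ := by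
        simpa using measure_univ_mul_lintegral_sub_average_le hint
    _ ≤ (n * ENNReal.ofReal s * ∫⁻ x in axisCube a s, ‖g x‖ₑ) *
          (2 ^ n * volume (axisCube a s)) := by
        grw [h.lintegral_lintegral_sub_le hm.1 hm.2 (convex_axisCube a s)
          (measurableSet_axisCube a s), ediam_axisCube_le, hdiff]
    _ = volume (axisCube a s) *
          (n * 2 ^ n * ENNReal.ofReal s * ∫⁻ x in axisCube a s, ‖g x‖ₑ) := by ring
  exact (ENNReal.mul_le_mul_iff_right (volume_axisCube_ne_zero a hs)
    (volume_axisCube_ne_top a s)).1 hmul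

theorem ofReal_mul_lintegral_enorm_axisCube_le (hn : 1 ≤ n) {F : Type*} [NormedAddCommGroup F]
    {u : EuclideanSpace ℝ (Fin n) → F} {a : EuclideanSpace ℝ (Fin n)} {s : ℝ} (hs : 0 < s)
    (hu : AEStronglyMeasurable u (volume.restrict (axisCube a s))) :
    ENNReal.ofReal s * ∫⁻ x in axisCube a s, ‖u x‖ₑ ≤
      eLpNorm u n (volume.restrict (axisCube a s)) * volume (axisCube a s) := by
  have hn' : (n : ℝ) ≠ 0 := Nat.cast_ne_zero.2 (Nat.one_le_iff_ne_zero.1 hn)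
  have hholder := eLpNorm_le_eLpNorm_mul_rpow_measure_univ (p := 1) (q := n)
    (by exact_mod_cast hn) hu
  rw [eLpNorm_one_eq_lintegral_enorm, Measure.restrict_apply_univ, volume_axisCube,
    ← ENNReal.rpow_natCast, ← ENNReal.rpow_mul, ENNReal.toReal_one, ENNReal.toReal_natCast,
    show (n : ℝ) * (1 / 1 - 1 / n) = n - 1 by field_simp] at hholder
  have hpow : ENNReal.ofReal s * ENNReal.ofReal s ^ ((n : ℝ) - 1) = ENNReal.ofReal s ^ n := by
    rw [ENNReal.ofReal_rpow_of_pos hs, ← ENNReal.ofReal_mul hs.le, ← ENNReal.ofReal_pow hs.le,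
      Real.rpow_sub_one hs.ne', mul_div_cancel₀ _ hs.ne', Real.rpow_natCast]
  grw [hholder, volume_axisCube, ← hpow, mul_left_comm]

theorem IsWeakGradient.meanOscillation_le (h : IsWeakGradient Set.univ f g) (hn : 1 ≤ n)
    (a : EuclideanSpace ℝ (Fin n)) {s : ℝ} (hs : 0 < s) :
    meanOscillation f a s ≤ n * 2 ^ n * eLpNorm g n (volume.restrict (axisCube a s)) := by
  rw [meanOscillation_le_iff hs, mul_assoc (n * 2 ^ n : ℝ≥0∞)]
  grw [h.lintegral_sub_average_axisCube_le a hs, mul_assoc,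
    ofReal_mul_lintegral_enorm_axisCube_le hn hs
      h.locallyIntegrable_gradient.aestronglyMeasurable.restrict]

theorem IsWeakGradient.bmoSeminorm_le (h : IsWeakGradient Set.univ f g) (hn : 1 ≤ n) :
    bmoSeminorm f ≤ n * 2 ^ n * eLpNorm g n volume :=
  iSup_le fun a => iSup₂_le fun s hs => by
    refine (h.meanOscillation_le hn a hs).trans ?_
    gcongr
    exact Measure.restrict_le_self

theorem IsWeakGradient.memBMO (h : IsWeakGradient Set.univ f g) (hn : 1 ≤ n)
    (hg : eLpNorm g n volume ≠ ⊤) : MemBMO f := by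
  refine ⟨h.locallyIntegrable, (h.bmoSeminorm_le hn).trans_lt ?_⟩
  exact ENNReal.mul_lt_top (ENNReal.mul_lt_top (by simp) (by simp)) hg.lt_top

end WeakGradient

/-! ### Extension by zero -/

theorem tendsto_integral_mul_of_tendsto_eLpNorm_sub {X ι : Type*} [MeasurableSpace X]
    {μ : Measure X} {p q : ℝ≥0∞} [ENNReal.HolderTriple p q 1] {l : Filter ι} {w : ι → X → ℝ}
    {w₀ u : X → ℝ} (hw : ∀ k, MemLp (w k) p μ) (hw₀ : MemLp w₀ p μ) (hu : MemLp u q μ)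
    (hlim : Tendsto (fun k => eLpNorm (fun x => w k x - w₀ x) p μ) l (𝓝 0)) :
    Tendsto (fun k => ∫ x, w k x * u x ∂μ) l (𝓝 (∫ x, w₀ x * u x ∂μ)) := by
  have hint {v : X → ℝ} (hv : MemLp v p μ) : Integrable (fun x => v x * u x) μ :=
    memLp_one_iff_integrable.1 (hu.mul hv)
  refine tendsto_integral_of_L1' _ (hint hw₀).aestronglyMeasurable
    (Eventually.of_forall fun k => hint (hw k)) ?_
  have hholder (k : ι) : eLpNorm ((fun x => w k x * u x) - fun x => w₀ x * u x) 1 μ ≤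
      eLpNorm (fun x => w k x - w₀ x) p μ * eLpNorm u q μ := by
    refine le_of_eq_of_le (eLpNorm_congr_ae (Eventually.of_forall fun x => ?_))
      (eLpNorm_smul_le_mul_eLpNorm hu.1 ((hw k).1.sub hw₀.1))
    simp [sub_mul]
  refine tendsto_of_tendsto_of_tendsto_of_le_of_le tendsto_const_nhds ?_
    (fun _ => zero_le) hholder
  simpa using ENNReal.Tendsto.mul_const hlim (Or.inr hu.eLpNorm_ne_top)

section Extension

variable {n : ℕ} {Ω : Set (EuclideanSpace ℝ (Fin n))} {f φ : EuclideanSpace ℝ (Fin n) → ℝ}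
  {g : EuclideanSpace ℝ (Fin n) → EuclideanSpace ℝ (Fin n)}

theorem IsTestFunction.setIntegral_mul_gradient {ψ : EuclideanSpace ℝ (Fin n) → ℝ}
    (hψ : IsTestFunction Ω ψ) (hφ : ContDiff ℝ ∞ φ) (i : Fin n) :
    ∫ x in Ω, ψ x * (gradient φ x) i = -∫ x in Ω, (gradient ψ x) i * φ x := by
  have hψ_zero (x) (hx : x ∉ Ω) : ψ x = 0 :=
    image_eq_zero_of_notMem_tsupport fun h => hx (hψ.2.2 h)
  have hgradψ_zero (x) (hx : x ∉ Ω) : (gradient ψ x) i = 0 := by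
    rw [gradient_apply, fderiv_of_notMem_tsupport ℝ fun h => hx (hψ.2.2 h)]
    rfl
  rw [setIntegral_eq_integral_of_forall_compl_eq_zero fun x hx => by rw [hψ_zero x hx, zero_mul],
    setIntegral_eq_integral_of_forall_compl_eq_zero fun x hx => by
      rw [hgradψ_zero x hx, zero_mul]]
  have hgradφ := continuous_gradient_apply hφ i
  have hgradψ := continuous_gradient_apply hψ.1 i
  have hgradψ_supp := hasCompactSupport_gradient_apply hψ.2.1 i
  simp only [gradient_apply] at hgradφ hgradψ hgradψ_supp ⊢
  exact integral_mul_fderiv_eq_neg_fderiv_mul_of_integrable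
    ((hgradψ.mul hφ.continuous).integrable_of_hasCompactSupport hgradψ_supp.mul_right)
    ((hψ.1.continuous.mul hgradφ).integrable_of_hasCompactSupport hψ.2.1.mul_right)
    ((hψ.1.continuous.mul hφ.continuous).integrable_of_hasCompactSupport hψ.2.1.mul_right)
    (fun x _ => hψ.1.differentiable (by simp) x) fun x _ => hφ.differentiable (by simp) x

theorem MemH10.setIntegral_mul_gradient (h : MemH10 Ω f g) (hφ : ContDiff ℝ ∞ φ)
    (hs : HasCompactSupport φ) (i : Fin n) :
    ∫ x in Ω, f x * (gradient φ x) i = -∫ x in Ω, (g x) i * φ x := by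
  obtain ⟨⟨-, hf, hg⟩, ψ, hψ, hlim, hlim_grad⟩ := h
  have hL2 {u : EuclideanSpace ℝ (Fin n) → ℝ} (hu : Continuous u) (hus : HasCompactSupport u) :
      MemLp u 2 (volume.restrict Ω) := (hu.memLp_of_hasCompactSupport hus).restrict Ω
  have hgrad_L2 {u : EuclideanSpace ℝ (Fin n) → ℝ} (hu : ContDiff ℝ ∞ u)
      (hus : HasCompactSupport u) : MemLp (fun x => (gradient u x) i) 2 (volume.restrict Ω) :=
    hL2 (continuous_gradient_apply hu i) (hasCompactSupport_gradient_apply hus i)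
  have hlim_coord : Tendsto (fun k => eLpNorm (fun x => (gradient (ψ k) x) i - (g x) i) 2
      (volume.restrict Ω)) atTop (𝓝 0) :=
    tendsto_of_tendsto_of_tendsto_of_le_of_le tendsto_const_nhds hlim_grad (fun _ => zero_le)
      fun k => eLpNorm_mono fun x => PiLp.norm_apply_le (gradient (ψ k) x - g x) i
  have hlhs := tendsto_integral_mul_of_tendsto_eLpNorm_sub
    (fun k => hL2 (hψ k).1.continuous (hψ k).2.1) hf (hgrad_L2 hφ hs) hlim
  have hrhs := tendsto_integral_mul_of_tendsto_eLpNorm_sub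
    (fun k => hgrad_L2 (hψ k).1 (hψ k).2.1) ((EuclideanSpace.proj (𝕜 := ℝ) i).comp_memLp' hg)
    (hL2 hφ.continuous hs) hlim_coord
  exact tendsto_nhds_unique hlhs
    (hrhs.neg.congr fun k => ((hψ k).setIntegral_mul_gradient hφ i).symm)

theorem MemH10.isWeakGradient_indicator (h : MemH10 Ω f g) (hΩ : MeasurableSet Ω) :
    IsWeakGradient Set.univ (Ω.indicator f) (Ω.indicator g) := by
  have hf : MemLp (Ω.indicator f) 2 volume := (memLp_indicator_iff_restrict hΩ).2 h.1.2.1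
  have hg : MemLp (Ω.indicator g) 2 volume := (memLp_indicator_iff_restrict hΩ).2 h.1.2.2
  refine ⟨locallyIntegrableOn_univ.2 (hf.locallyIntegrable one_le_two),
    locallyIntegrableOn_univ.2 (hg.locallyIntegrable one_le_two), fun φ hφ i => ?_⟩
  have hf_eq : ∫ x, Ω.indicator f x * (gradient φ x) i = ∫ x in Ω, f x * (gradient φ x) i := by
    simp only [← integral_indicator hΩ, Set.indicator_mul_left]
  have hg_eq : ∫ x, (Ω.indicator g x) i * φ x = ∫ x in Ω, (g x) i * φ x := by
    rw [← integral_indicator hΩ]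
    refine integral_congr_ae (Eventually.of_forall fun x => ?_)
    by_cases hx : x ∈ Ω <;> simp [hx]
  rw [Measure.restrict_univ, hf_eq, hg_eq, h.setIntegral_mul_gradient hφ.1 hφ.2.1]

end Extension

/-! ### The weak Ladyzhenskaya inequality -/

theorem memWeakLp_of_memLp {X : Type*} [MeasurableSpace X] {μ : Measure X} {f : X → ℝ} {p : ℝ}
    (hp : 0 < p) (hf : MemLp f (ENNReal.ofReal p) μ) : MemWeakLp f p μ :=
  ⟨hf.1, (weakLpNorm_le_eLpNorm hp hf.1).trans_lt hf.2⟩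

section Ladyzhenskaya

variable {n : ℕ} {q p : ℝ} {f : EuclideanSpace ℝ (Fin n) → ℝ}
  {g : EuclideanSpace ℝ (Fin n) → EuclideanSpace ℝ (Fin n)}

/-- The constant of the weak Ladyzhenskaya inequality between `L^{q,∞}` and `L^p` in `ℝⁿ`, obtained
by inserting the bound `n 2ⁿ ‖∇f‖_{Lⁿ}` for the `BMO` seminorm into the interpolation
inequality. -/
noncomputable def weakLadyzhenskayaConst (n : ℕ) (q p : ℝ) : ℝ≥0 :=
  Real.toNNReal (weakBMOConst n q p ^ (1 / p)) * (n * 2 ^ n) ^ (1 - q / p)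

theorem weakLadyzhenskayaConst_mul (hp : 0 < p) (hqp : q < p) (w b : ℝ≥0∞) :
    weakLadyzhenskayaConst n q p * w * b ^ (1 - q / p) =
      ENNReal.ofReal (weakBMOConst n q p ^ (1 / p)) * w * (n * 2 ^ n * b) ^ (1 - q / p) := by
  have hexp : 0 ≤ 1 - q / p := sub_nonneg.2 ((div_le_one hp).2 hqp.le)
  rw [weakLadyzhenskayaConst, ENNReal.coe_mul, ENNReal.coe_rpow_of_nonneg _ hexp,
    ENNReal.mul_rpow_of_nonneg _ _ hexp, ENNReal.ofReal]
  push_cast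
  ring

theorem IsWeakGradient.memLp_and_eLpNorm_le (h : IsWeakGradient Set.univ f g) (hn : 1 ≤ n)
    (hq : 0 < q) (hqp : q < p) (hf : MemWeakLp f q volume) (hg : MemLp g n volume) :
    MemLp f (ENNReal.ofReal p) volume ∧
      eLpNorm f (ENNReal.ofReal p) volume ≤
        weakLadyzhenskayaConst n q p * weakLpNorm f q volume ^ (q / p) *
          eLpNorm g n volume ^ (1 - q / p) := by
  have hexp : 0 ≤ 1 - q / p := sub_nonneg.2 ((div_le_one (hq.trans hqp)).2 hqp.le)
  obtain ⟨hmem, hle⟩ := memLp_and_eLpNorm_le_weakLpNorm_mul_bmoSeminorm hn hq hqp hf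
    (h.memBMO hn hg.eLpNorm_ne_top)
  refine ⟨hmem, hle.trans ?_⟩
  rw [weakLadyzhenskayaConst_mul (hq.trans hqp) hqp]
  gcongr
  exact h.bmoSeminorm_le hn

theorem MemH10.memLp_and_eLpNorm_le {Ω : Set (EuclideanSpace ℝ (Fin n))} (h : MemH10 Ω f g)
    (hΩ : MeasurableSet Ω) (hn : 1 ≤ n) (hq : 0 < q) (hqp : q < p)
    (hf : MemWeakLp f q (volume.restrict Ω)) (hg : MemLp g n (volume.restrict Ω)) :
    MemLp f (ENNReal.ofReal p) (volume.restrict Ω) ∧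
      eLpNorm f (ENNReal.ofReal p) (volume.restrict Ω) ≤
        weakLadyzhenskayaConst n q p * weakLpNorm f q (volume.restrict Ω) ^ (q / p) *
          eLpNorm g n (volume.restrict Ω) ^ (1 - q / p) := by
  rw [← memLp_indicator_iff_restrict hΩ] at hg
  have hf_ext : MemWeakLp (Ω.indicator f) q volume :=
    ⟨(aestronglyMeasurable_indicator_iff hΩ).2 hf.1, (weakLpNorm_indicator hΩ).trans_lt hf.2⟩
  simpa only [memLp_indicator_iff_restrict hΩ, eLpNorm_indicator_eq_eLpNorm_restrict hΩ,
    weakLpNorm_indicator hΩ] using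
    (h.isWeakGradient_indicator hΩ).memLp_and_eLpNorm_le hn hq hqp hf_ext hg

theorem IsWeakGradient.memLp_and_eLpNorm_axisCube_le (h : IsWeakGradient Set.univ f g)
    (hn : 1 ≤ n) (hq : 0 < q) (hqp : q < p) {a : EuclideanSpace ℝ (Fin n)} {s : ℝ} (hs : 0 < s)
    (hf : MemWeakLp f q (volume.restrict (axisCube a s)))
    (hg : MemLp g n (volume.restrict (axisCube a s))) (havg : ∫ x in axisCube a s, f x = 0) :
    MemLp f (ENNReal.ofReal p) (volume.restrict (axisCube a s)) ∧
      eLpNorm f (ENNReal.ofReal p) (volume.restrict (axisCube a s)) ≤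
        weakLadyzhenskayaConst n q p * weakLpNorm f q (volume.restrict (axisCube a s)) ^ (q / p) *
          eLpNorm g n (volume.restrict (axisCube a s)) ^ (1 - q / p) := by
  rw [weakLadyzhenskayaConst_mul (hq.trans hqp) hqp]
  refine memLp_and_eLpNorm_axisCube_le_weakLpNorm_mul hs h.locallyIntegrable hf.2.ne hq hqp
    (ENNReal.mul_ne_top (by finiteness) hg.eLpNorm_ne_top) (fun a' r hr hsub => ?_) havg
  grw [h.meanOscillation_le hn a' hr, hsub]

end Ladyzhenskaya

theorem mainTheorem2_general {n : ℕ} (hn : 1 ≤ n) {q p : ℝ} (hq : 0 < q) (hqp : q < p) :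
    (∃ c : ℝ≥0, ∀ f : EuclideanSpace ℝ (Fin n) → ℝ, MemWeakLp f q volume → MemBMO f →
      MemLp f (ENNReal.ofReal p) volume ∧
      eLpNorm f (ENNReal.ofReal p) volume ≤
        c * weakLpNorm f q volume ^ (q / p) * bmoSeminorm f ^ (1 - q / p)) ∧
    (∃ c : ℝ≥0, ∀ (f : EuclideanSpace ℝ (Fin n) → ℝ)
        (g : EuclideanSpace ℝ (Fin n) → EuclideanSpace ℝ (Fin n)),
      IsWeakGradient Set.univ f g → MemLp g n volume →
      MemBMO f ∧ bmoSeminorm f ≤ c * eLpNorm g n volume) ∧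
    (∃ c : ℝ≥0, ∀ (f : EuclideanSpace ℝ (Fin n) → ℝ)
        (g : EuclideanSpace ℝ (Fin n) → EuclideanSpace ℝ (Fin n)),
      MemWeakLp f q volume → IsWeakGradient Set.univ f g → MemLp g n volume →
      MemLp f (ENNReal.ofReal p) volume ∧
      eLpNorm f (ENNReal.ofReal p) volume ≤
        c * weakLpNorm f q volume ^ (q / p) * eLpNorm g n volume ^ (1 - q / p)) ∧
    (∃ c : ℝ≥0, ∀ Ω : Set (EuclideanSpace ℝ (Fin n)), IsOpen Ω →
        ∀ (f : EuclideanSpace ℝ (Fin n) → ℝ)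
          (g : EuclideanSpace ℝ (Fin n) → EuclideanSpace ℝ (Fin n)), MemH10 Ω f g →
      MemWeakLp f q (volume.restrict Ω) → MemLp g n (volume.restrict Ω) →
      MemLp f (ENNReal.ofReal p) (volume.restrict Ω) ∧
      eLpNorm f (ENNReal.ofReal p) (volume.restrict Ω) ≤
        c * weakLpNorm f q (volume.restrict Ω) ^ (q / p) *
          eLpNorm g n (volume.restrict Ω) ^ (1 - q / p)) ∧
    (∃ c : ℝ≥0, ∀ (a : EuclideanSpace ℝ (Fin n)) (s : ℝ), 0 < s →
        ∀ (f : EuclideanSpace ℝ (Fin n) → ℝ)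
          (g : EuclideanSpace ℝ (Fin n) → EuclideanSpace ℝ (Fin n)), IsWeakGradient Set.univ f g →
      MemWeakLp f q (volume.restrict (axisCube a s)) →
      MemLp g n (volume.restrict (axisCube a s)) → (∫ x in axisCube a s, f x) = 0 →
      MemLp f (ENNReal.ofReal p) (volume.restrict (axisCube a s)) ∧
      eLpNorm f (ENNReal.ofReal p) (volume.restrict (axisCube a s)) ≤
        c * weakLpNorm f q (volume.restrict (axisCube a s)) ^ (q / p) *
          eLpNorm g n (volume.restrict (axisCube a s)) ^ (1 - q / p)) :=
  ⟨⟨Real.toNNReal _, fun _ hf hbmo =>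
      memLp_and_eLpNorm_le_weakLpNorm_mul_bmoSeminorm hn hq hqp hf hbmo⟩,
    ⟨n * 2 ^ n, fun _ _ h hg => ⟨h.memBMO hn hg.eLpNorm_ne_top,
      by simpa using h.bmoSeminorm_le hn⟩⟩,
    ⟨_, fun _ _ hf h hg => h.memLp_and_eLpNorm_le hn hq hqp hf hg⟩,
    ⟨_, fun _ hΩ _ _ h hf hg => h.memLp_and_eLpNorm_le hΩ.measurableSet hn hq hqp hf hg⟩,
    ⟨_, fun _ _ hs _ _ h hf hg havg =>
      h.memLp_and_eLpNorm_axisCube_le hn hq hqp hs hf hg havg⟩⟩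

theorem mainTheorem2 :
    -- interpolation between weak Lebesgue spaces and `BMO` on `ℝⁿ`
    (∀ (n : ℕ) (q p : ℝ), 1 ≤ n → 1 ≤ q → q < p →
      ∃ c : ℝ≥0, ∀ f : EuclideanSpace ℝ (Fin n) → ℝ, MemWeakLp f q volume → MemBMO f →
        MemLp f (ENNReal.ofReal p) volume ∧
        eLpNorm f (ENNReal.ofReal p) volume ≤
          c * weakLpNorm f q volume ^ (q / p) * bmoSeminorm f ^ (1 - q / p)) ∧
    -- `Ḣ¹(ℝ²) ⊂ BMO(ℝ²)`
    (∃ c : ℝ≥0, ∀ (f : EuclideanSpace ℝ (Fin 2) → ℝ)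
        (g : EuclideanSpace ℝ (Fin 2) → EuclideanSpace ℝ (Fin 2)), MemHomH1 f g →
        MemBMO f ∧ bmoSeminorm f ≤ c * eLpNorm g 2 volume) ∧
    -- weak Ladyzhenskaya inequality on `ℝ²`
    (∃ c : ℝ≥0, ∀ (f : EuclideanSpace ℝ (Fin 2) → ℝ)
        (g : EuclideanSpace ℝ (Fin 2) → EuclideanSpace ℝ (Fin 2)),
        MemWeakLp f 2 volume → MemHomH1 f g →
        MemLp f 4 volume ∧
        eLpNorm f 4 volume ≤
          c * weakLpNorm f 2 volume ^ (1 / 2 : ℝ) * eLpNorm g 2 volume ^ (1 / 2 : ℝ)) ∧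
    -- weak Ladyzhenskaya inequality on bounded open subsets of the plane
    (∃ c : ℝ≥0, ∀ Ω : Set (EuclideanSpace ℝ (Fin 2)), IsOpen Ω → Bornology.IsBounded Ω →
        ∀ (f : EuclideanSpace ℝ (Fin 2) → ℝ)
          (g : EuclideanSpace ℝ (Fin 2) → EuclideanSpace ℝ (Fin 2)), MemH10 Ω f g →
        MemLp f 4 (volume.restrict Ω) ∧
        eLpNorm f 4 (volume.restrict Ω) ≤
          c * weakLpNorm f 2 (volume.restrict Ω) ^ (1 / 2 : ℝ) *
            eLpNorm g 2 (volume.restrict Ω) ^ (1 / 2 : ℝ)) ∧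
    -- weak Ladyzhenskaya inequality on `[0,1]²` with periodic boundary conditions
    (∃ c : ℝ≥0, ∀ (f : EuclideanSpace ℝ (Fin 2) → ℝ)
        (g : EuclideanSpace ℝ (Fin 2) → EuclideanSpace ℝ (Fin 2)), MemH1Per f g →
        (∫ x in axisCube 0 1, f x) = 0 →
        MemLp f 4 (volume.restrict (axisCube 0 1)) ∧
        eLpNorm f 4 (volume.restrict (axisCube 0 1)) ≤
          c * weakLpNorm f 2 (volume.restrict (axisCube 0 1)) ^ (1 / 2 : ℝ) *
            eLpNorm g 2 (volume.restrict (axisCube 0 1)) ^ (1 / 2 : ℝ)) := by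
  obtain ⟨-, hbmo, hplane, hopen, hcube⟩ :=
    mainTheorem2_general (n := 2) one_le_two (q := 2) (p := 4) two_pos (by norm_num)
  have hweak {X : Type} [MeasurableSpace X] {μ : Measure X} {f : X → ℝ} (hf : MemLp f 2 μ) :
      MemWeakLp f 2 μ := memWeakLp_of_memLp two_pos (by simpa using hf)
  simp only [Nat.cast_ofNat, ENNReal.ofReal_ofNat, show (2 / 4 : ℝ) = 1 / 2 by norm_num,
    show (1 - 1 / 2 : ℝ) = 1 / 2 by norm_num] at hbmo hplane hopen hcube
  exact ⟨fun n q p hn hq hqp => (mainTheorem2_general hn (one_pos.trans_le hq) hqp).1,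
    hbmo.imp fun _ hc f g h => hc f g h.1 h.2,
    hplane.imp fun _ hc f g hf h => hc f g hf h.1 h.2,
    hopen.imp fun _ hc Ω hΩ _ f g h => hc Ω hΩ f g h (hweak h.1.2.1) h.1.2.2,
    hcube.imp fun _ hc f g h => hc 0 1 one_pos f g h.2.1 (hweak h.2.2.1) h.2.2.2⟩
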